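/- Let $n\ge 2$, let $\mathbb H^n=\{p\in\mathbb R^{n+1} : p_1^2+\dots+p_n^2-p_{n+1}^2=-1,\ p_{n+1}>0\}$ with its hyperbolic metric, and let $\mathbb H^n\times_{-1}\mathbb R$ be $\mathbb H^n\times\mathbb R$ with the Lorentzian metric $g_{\mathbb H^n}-dt^2$. A space-like translator is an embedded space-like hypersurface whose mean curvature vector $\mathbf H$ (the trace of the second fundamental form) equals the normal part $\partial_t^\perp$ of $\partial_t$; it is rotationally symmetric if it is invariant under $SO(n)$ acting on $p_1,\dots,p_n$. Put $o=(0,\dots,0,1)$ and let $\tau(p)=\ln\bigl(\sqrt{p_{n+1}^2-1}+p_{n+1}\bigr)$ be the hyperbolic distance from $p$ to $o$. A *profile* is a pair of a continuous $f:[0,\infty)\to\mathbb R$ and $w:(0,\infty)\to(-1,1)$ with $f'=w$ and $$w'(s)=(1-w(s)^2)\bigl(1-(n-1)\coth(s)\,w(s)\bigr),\qquad s>0 .$$ **Theorem 4.1.** 1. Every connected, rotationally symmetric space-like translator of class $C^2$ in $\mathbb H^n\times_{-1}\mathbb R$ is the graph $\{(p,f(\tau(p))) : p\in\mathbb H^n,\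 \tau(p)\in J\}$ for a profile $(f,w)$ and an interval $J$ that is relatively open in $[0,\infty)$. The profile is uniquely determined by the translator. If the translator meets the axis $\{o\}\times\mathbb R$ (that is, if $0\in J$), then $\lim_{s\to0^+}w(s)=0$. 2. For every profile, exactly one of $\lim_{s\to0^+}w(s)=0$, $\lim_{s\to0^+}w(s)=1$, $\lim_{s\to0^+}w(s)=-1$ holds. 3. (The bowl.) Profiles with $\lim_{s\to0^+}w(s)=0$ exist; their $w$ is unique, so that $f$ is unique up to an additive constant. The graph of $f\circ\tau$ over all of $\mathbb H^n$ is then a connected, rotationally symmetric space-like translator of class $C^\infty$. 4. For each $\sigma\in\{1,-1\}$, profiles with $\lim_{s\to0^+}w(s)=\sigma$ exist. For each of them the graph of $f\circ\tau$ over $\mathbb H^n\setminus\{o\}$ is a connected, rotationally symmetric space-like translator of class $C^\infty$, and the graph over $\mathbb H^n$ has a conic singularity on the axis: $\dfrac{f(\tau(p))-f(0)}{\tau(p)}\to\sigma$ as $p\to o$ in $\mathbb H^n\setminus\{o\}$ (it meets the axis at an angle of $\pi/4$), and it is not a $C^1$ hypersurface. -/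

import Mathlib

open Set Filter Topology
open scoped ContDiff

noncomputable section

namespace HESU

/-- Euclidean `n`-space, used for the space coordinates `x₁, …, xₙ`. -/
abbrev E (n : ℕ) : Type := EuclideanSpace ℝ (Fin n)

/-- The vector space of the Lorentz space `𝕃ⁿ⁺¹`; `p.1` collects the coordinates `x₁, …, xₙ` and
`p.2` is the time-like coordinate `xₙ₊₁`. -/
abbrev L (n : ℕ) : Type := E n × ℝ

/-- The flat space `𝕃ⁿ⁺¹ × ℝ` that contains `ℍⁿ × ℝ`. -/
abbrev Ambient (n : ℕ) : Type := L n × ℝ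

/-- The Lorentz product `x₁y₁ + … + xₙyₙ - xₙ₊₁yₙ₊₁`. -/
def lor {n : ℕ} (p q : L n) : ℝ := inner ℝ p.1 q.1 - p.2 * q.2

/-- The hyperboloid model of `ℍⁿ`. -/
def hyp (n : ℕ) : Set (L n) := {p | lor p p = -1 ∧ 0 < p.2}

/-- The base point of `ℍⁿ` fixed by the rotations; `{origin} × ℝ` is the axis of rotation. -/
def origin (n : ℕ) : L n := (0, 1)

/-- The flat metric `⟨,⟩_L - dt²`. It restricts to `g_{ℍⁿ} - dt²` on the tangent spaces of
`ℍⁿ × ℝ`. -/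
def g {n : ℕ} (v w : Ambient n) : ℝ := lor v.1 w.1 - v.2 * w.2

/-- The vertical vector field `∂_t`. -/
def dt (n : ℕ) : Ambient n := (0, 1)

/-- The hyperbolic Einstein static universe `ℍⁿ ×₋₁ ℝ`, as a subset of the flat space. -/
def space (n : ℕ) : Set (Ambient n) := {q | q.1 ∈ hyp n}

/-- The hyperbolic distance to `origin`, `τ = ln (√(ρ² - 1) + ρ)` with `ρ(p) = pₙ₊₁`. -/
def tau {n : ℕ} (p : L n) : ℝ := Real.log (√(p.2 ^ 2 - 1) + p.2)

/-- `X`, on the open set `U` of `ℝⁿ`, is a regular `C^k` local parametrization of `S`: an immersion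
and a homeomorphism onto a relatively open subset of `S`. -/
structure IsLocalParam {n : ℕ} (k : WithTop ℕ∞) (S : Set (Ambient n)) (U : Set (E n))
    (X : E n → Ambient n) : Prop where
  isOpen : IsOpen U
  contDiffOn : ContDiffOn ℝ k X U
  immersion : ∀ x ∈ U, Function.Injective (fderiv ℝ X x)
  isEmbedding : IsEmbedding (U.domRestrict X)
  image_eq : ∃ V : Set (Ambient n), IsOpen V ∧ X '' U = S ∩ V

/-- `S` is an (embedded) `C^k` hypersurface of `ℍⁿ ×₋₁ ℝ`. -/
def IsHypersurface {n : ℕ} (k : WithTop ℕ∞) (S : Set (Ambient n)) : Prop :=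
  S ⊆ space n ∧ ∀ q ∈ S, ∃ (U : Set (E n)) (X : E n → Ambient n),
    IsLocalParam k S U X ∧ q ∈ X '' U

/-- The `i`-th coordinate vector of `ℝⁿ`. -/
def basisVec {n : ℕ} (i : Fin n) : E n := EuclideanSpace.single i 1

/-- `∂ᵢX` at `x`. -/
def pd {n : ℕ} (X : E n → Ambient n) (i : Fin n) (x : E n) : Ambient n :=
  fderiv ℝ X x (basisVec i)

/-- `∂ᵢ∂ⱼX` at `x`. -/
def pd₂ {n : ℕ} (X : E n → Ambient n) (i j : Fin n) (x : E n) : Ambient n :=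
  fderiv ℝ (pd X j) x (basisVec i)

/-- The matrix `(gᵢⱼ)` of the induced metric of `X` at `x`. -/
def inducedMetric {n : ℕ} (X : E n → Ambient n) (x : E n) : Matrix (Fin n) (Fin n) ℝ :=
  Matrix.of fun i j => g (pd X i x) (pd X j x)

/-- The induced metric of `X` at `x` is Riemannian. -/
def SpacelikeAt {n : ℕ} (X : E n → Ambient n) (x : E n) : Prop :=
  ∀ v : E n, v ≠ 0 → 0 < g (fderiv ℝ X x v) (fderiv ℝ X x v)

/-- `ν` is tangent to `ℍⁿ × ℝ` at `X x` and orthogonal to the image of the differential of `X`. -/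
def IsNormalVec {n : ℕ} (X : E n → Ambient n) (x : E n) (ν : Ambient n) : Prop :=
  lor (X x).1 ν.1 = 0 ∧ ∀ v : E n, g (fderiv ℝ X x v) ν = 0

/-- `h` is the orthogonal projection of `v` to the normal space of `X` at `x`. -/
def IsNormalPart {n : ℕ} (X : E n → Ambient n) (x : E n) (v h : Ambient n) : Prop :=
  IsNormalVec X x h ∧ ∀ ν, IsNormalVec X x ν → g h ν = g v ν

/-- `H` is the mean curvature vector of `X` at `x`, the trace of the second fundamental form in
`ℍⁿ ×₋₁ ℝ`. As `ℍⁿ × ℝ` carries the metric induced from the flat space, the second fundamental form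
on `∂ᵢX, ∂ⱼX` is the normal part of `∂ᵢ∂ⱼX`, so `H` is the normal part of `∑ gⁱʲ ∂ᵢ∂ⱼX`. -/
def IsMeanCurvatureVec {n : ℕ} (X : E n → Ambient n) (x : E n) (H : Ambient n) : Prop :=
  IsNormalPart X x (∑ i, ∑ j, (inducedMetric X x)⁻¹ i j • pd₂ X i j x) H

/-- The translator equation `H = (∂_t)^⊥` at `x`. -/
def TranslatorAt {n : ℕ} (X : E n → Ambient n) (x : E n) : Prop :=
  ∃ H : Ambient n, IsMeanCurvatureVec X x H ∧ IsNormalPart X x (dt n) H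

/-- `S` is a space-like translator of class `C^k` in `ℍⁿ ×₋₁ ℝ`. (Being space-like and the mean
curvature vector do not depend on the parametrization.) -/
def IsSpacelikeTranslator {n : ℕ} (k : WithTop ℕ∞) (S : Set (Ambient n)) : Prop :=
  S ⊆ space n ∧ ∀ q ∈ S, ∃ (U : Set (E n)) (X : E n → Ambient n),
    IsLocalParam k S U X ∧ q ∈ X '' U ∧ ∀ x ∈ U, SpacelikeAt X x ∧ TranslatorAt X x

/-- Invariance under `SO(n)`, acting on the coordinates `x₁, …, xₙ`. -/
def IsRotationInvariant {n : ℕ} (S : Set (Ambient n)) : Prop :=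
  ∀ A : E n ≃ₗᵢ[ℝ] E n, LinearMap.det (A.toLinearEquiv : E n →ₗ[ℝ] E n) = 1 →
    ∀ q ∈ S, (((A q.1.1, q.1.2), q.2) : Ambient n) ∈ S

/-- `f : [0, ∞) → ℝ` is continuous with derivative `w` on `(0, ∞)`, and `w : (0, ∞) → (-1, 1)`
solves `w' = (1 - w²)(1 - (n - 1) coth(s) w)`. Values at negative `s`, and `w 0`, play no role. -/
structure IsProfile (n : ℕ) (f w : ℝ → ℝ) : Prop where
  continuousOn : ContinuousOn f (Ici 0)
  hasDerivAt : ∀ s, 0 < s → HasDerivAt f (w s) s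
  abs_lt_one : ∀ s, 0 < s → |w s| < 1
  ode : ∀ s, 0 < s → HasDerivAt w
    ((1 - w s ^ 2) * (1 - ((n : ℝ) - 1) * (Real.cosh s / Real.sinh s) * w s)) s

/-- The graph of `f ∘ τ` over `{p ∈ ℍⁿ | τ(p) ∈ J}`. -/
def radialGraph (n : ℕ) (f : ℝ → ℝ) (J : Set ℝ) : Set (Ambient n) :=
  {q | q.1 ∈ hyp n ∧ tau q.1 ∈ J ∧ q.2 = f (tau q.1)}

/-- The graph of `u : ℍⁿ → ℝ` has a conic singularity of slope `σ` on the axis: its tangent cone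
there is the cone `t = σ|v|`, `v ∈ T_origin ℍⁿ`, and it is not a `C¹` hypersurface. -/
def HasConicSingularity (n : ℕ) (u : L n → ℝ) (σ : ℝ) : Prop :=
  Tendsto (fun p => (u p - u (origin n)) / tau p) (𝓝[hyp n \ {origin n}] (origin n)) (𝓝 σ) ∧
    ¬ IsHypersurface 1 {q : Ambient n | q.1 ∈ hyp n ∧ q.2 = u q.1}

end HESU

end

/-! The hyperboloid is parametrized by its space coordinates y in ℝⁿ. A rotationally symmetric graph
is then a function of z = |y|², and the translator equation becomes a second order equation in z
(`translatorAt_graphMap_iff`). In the distance s = arsinh |y| it is the profile equation for the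
slope w (`translatorAt_radial_iff`), and being space-like means |w| < 1 (`spacelikeAt_radial_iff`).

Put m = n - 1. The difference of two slopes solves a homogeneous linear equation, so slopes are
ordered; in the variable artanh w the equation is Lipschitz, so slopes are global on (0, ∞). As s
decreases to 0, the region w ≤ 0 and the region on or above the nullcline w = tanh s / m are traps
in which w is eventually monotone. A limit other than 0, 1, -1 would force logarithmic growth, so
the traps give the limits -1 and 1, and a slope that avoids both is squeezed to 0
(`IsSlopeOn.trichotomy`). Shooting produces a slope of the last kind (`exists_slope_tendsto_zero`),
and a monotonicity argument at 0 makes it unique (`IsSlopeOn.eqOn_of_tendsto_zero`).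

For the classification, a space-like hypersurface projects to ℝⁿ by a local diffeomorphism, so it is
locally a graph; transitivity of SO(n) on spheres makes the graph radial, hence locally a piece of a
profile. Unique continuation of profiles and connectedness make the profile global.

At the axis, the bowl is smooth because p = 2 du/dz solves a singular equation which, integrated
along rays, expresses dp through p without derivatives and allows a bootstrap. In the cases ±1 every
differentiable curve in the graph has velocity zero at the tip, which excludes an immersion. -/

namespace HESU

/-! ### The slope equation: comparison and global solutions -/

/-- The right hand side of the profile equation, with `m = n - 1`. -/
noncomputable def slopeField (m s w : ℝ) : ℝ :=
  (1 - w ^ 2) * (1 - m * (Real.cosh s / Real.sinh s) * w)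

/-- `w` is a space-like solution of the profile equation on `I`. -/
def IsSlopeOn (m : ℝ) (w : ℝ → ℝ) (I : Set ℝ) : Prop :=
  ∀ s ∈ I, |w s| < 1 ∧ HasDerivAt w (slopeField m s (w s)) s

theorem IsSlopeOn.mono {m : ℝ} {w : ℝ → ℝ} {I J : Set ℝ} (h : IsSlopeOn m w I) (hJ : J ⊆ I) :
    IsSlopeOn m w J := fun s hs => h s (hJ hs)

theorem IsSlopeOn.continuousOn {m : ℝ} {w : ℝ → ℝ} {I : Set ℝ} (h : IsSlopeOn m w I) :
    ContinuousOn w I := fun s hs => (h s hs).2.continuousAt.continuousWithinAt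

theorem IsSlopeOn.congr {m : ℝ} {w v : ℝ → ℝ} {I : Set ℝ} (h : IsSlopeOn m w I) (hI : IsOpen I)
    (hv : EqOn v w I) : IsSlopeOn m v I := by
  intro s hs
  rw [hv hs]
  exact ⟨(h s hs).1, (h s hs).2.congr_of_eventuallyEq (hv.eventuallyEq_of_mem (hI.mem_nhds hs))⟩

theorem continuousOn_coth : ContinuousOn (fun s => Real.cosh s / Real.sinh s) (Ioi 0) :=
  Real.continuous_cosh.continuousOn.div Real.continuous_sinh.continuousOn fun _ hs =>
    (Real.sinh_pos_iff.2 hs).ne'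

theorem one_lt_coth {s : ℝ} (hs : 0 < s) : 1 < Real.cosh s / Real.sinh s := by
  rw [one_lt_div (Real.sinh_pos_iff.2 hs)]
  exact Real.sinh_lt_cosh s

/-- The solutions of a homogeneous linear equation keep their sign. -/
theorem exists_pos_eq_mul_of_hasDerivAt {d k : ℝ → ℝ} {I : Set ℝ} (hI : IsOpen I)
    (hc : I.OrdConnected) (hk : ContinuousOn k I) (hd : ∀ s ∈ I, HasDerivAt d (k s * d s) s)
    {s₀ s : ℝ} (hs₀ : s₀ ∈ I) (hs : s ∈ I) : ∃ c > 0, d s = c * d s₀ := by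
  set K : ℝ → ℝ := fun t => ∫ r in s₀..t, k r
  have hK : ∀ t ∈ I, HasDerivAt K (k t) t := by
    intro t ht
    refine intervalIntegral.integral_hasDerivAt_right ?_
      (hk.stronglyMeasurableAtFilter hI t ht) (hk.continuousAt (hI.mem_nhds ht))
    exact (hk.mono (hc.uIcc_subset hs₀ ht)).intervalIntegrable
  have hE : ∀ t ∈ I, HasDerivAt (fun t => d t * Real.exp (-K t)) 0 t := by
    intro t ht
    refine ((hd t ht).mul (hK t ht).neg.exp).congr_deriv ?_
    simp only [Pi.neg_apply]
    ring
  have hconst := hI.is_const_of_deriv_eq_zero hc.isPreconnected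
    (fun t ht => (hE t ht).differentiableAt.differentiableWithinAt)
    (fun t ht => (hE t ht).deriv) hs hs₀
  refine ⟨Real.exp (K s), Real.exp_pos _, ?_⟩
  have h0 : K s₀ = 0 := by simp [K]
  simp only [h0, neg_zero, Real.exp_zero, mul_one] at hconst
  rw [← hconst, mul_left_comm, ← Real.exp_add]
  simp

/-- The cubic nonlinearity factors, so the difference of two solutions solves d' = k d with k
continuous. This gives both uniqueness and the preservation of order. -/
theorem IsSlopeOn.exists_pos_sub_eq {m : ℝ} {w₁ w₂ : ℝ → ℝ} {I : Set ℝ} (hI : IsOpen I)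
    (hc : I.OrdConnected) (hpos : I ⊆ Ioi 0) (h₁ : IsSlopeOn m w₁ I) (h₂ : IsSlopeOn m w₂ I)
    {s₀ s : ℝ} (hs₀ : s₀ ∈ I) (hs : s ∈ I) : ∃ c > 0, w₁ s - w₂ s = c * (w₁ s₀ - w₂ s₀) := by
  have c₁ := h₁.continuousOn
  have c₂ := h₂.continuousOn
  have c₃ := continuousOn_coth.mono hpos
  refine exists_pos_eq_mul_of_hasDerivAt (d := fun s => w₁ s - w₂ s)
    (k := fun s => -(w₁ s + w₂ s) -
      m * (Real.cosh s / Real.sinh s) * (1 - w₁ s ^ 2 - w₁ s * w₂ s - w₂ s ^ 2))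
    hI hc (by fun_prop) ?_ hs₀ hs
  intro t ht
  refine ((h₁ t ht).2.sub (h₂ t ht).2).congr_deriv ?_
  simp only [slopeField]
  ring

theorem IsSlopeOn.eqOn {m : ℝ} {w₁ w₂ : ℝ → ℝ} {I : Set ℝ} (hI : IsOpen I)
    (hc : I.OrdConnected) (hpos : I ⊆ Ioi 0) (h₁ : IsSlopeOn m w₁ I) (h₂ : IsSlopeOn m w₂ I)
    {s₀ : ℝ} (hs₀ : s₀ ∈ I) (h : w₁ s₀ = w₂ s₀) : EqOn w₁ w₂ I := by
  intro s hs
  obtain ⟨c, -, hc⟩ := h₁.exists_pos_sub_eq hI hc hpos h₂ hs₀ hs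
  rw [h, sub_self, mul_zero] at hc
  linarith

theorem IsSlopeOn.lt {m : ℝ} {w₁ w₂ : ℝ → ℝ} {I : Set ℝ} (hI : IsOpen I)
    (hc : I.OrdConnected) (hpos : I ⊆ Ioi 0) (h₁ : IsSlopeOn m w₁ I) (h₂ : IsSlopeOn m w₂ I)
    {s₀ s : ℝ} (hs₀ : s₀ ∈ I) (h : w₁ s₀ < w₂ s₀) (hs : s ∈ I) : w₁ s < w₂ s := by
  obtain ⟨c, hc0, hc⟩ := h₂.exists_pos_sub_eq hI hc hpos h₁ hs₀ hs
  have := mul_pos hc0 (sub_pos.2 h)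
  linarith

theorem hasDerivAt_tanh (x : ℝ) : HasDerivAt Real.tanh (1 - Real.tanh x ^ 2) x := by
  have h := (Real.hasDerivAt_sinh x).div (Real.hasDerivAt_cosh x) (Real.cosh_pos x).ne'
  have h' : Real.tanh = fun x => Real.sinh x / Real.cosh x :=
    funext fun x => Real.tanh_eq_sinh_div_cosh x
  rw [h']
  refine h.congr_deriv ?_
  have := (Real.cosh_pos x).ne'
  field_simp

theorem lipschitzWith_tanh : LipschitzWith 1 Real.tanh := by
  refine lipschitzWith_of_nnnorm_deriv_le (fun x => (hasDerivAt_tanh x).differentiableAt) ?_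
  intro x
  rw [(hasDerivAt_tanh x).deriv, ← NNReal.coe_le_coe, coe_nnnorm, Real.norm_eq_abs, abs_le]
  have := Real.abs_tanh_lt_one x
  rw [← sq_lt_one_iff_abs_lt_one] at this
  constructor <;> simp <;> nlinarith [sq_nonneg (Real.tanh x)]

/-- In the variable `artanh w` the profile equation is Lipschitz with bounded right hand side, so
it has a solution on each compact interval. -/
theorem exists_slope_Ioo (m : ℝ) {a b s₀ w₀ : ℝ} (ha : 0 < a) (hs₀ : s₀ ∈ Icc a b)
    (hw₀ : |w₀| < 1) : ∃ w : ℝ → ℝ, w s₀ = w₀ ∧ IsSlopeOn m w (Ioo a b) := by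
  have hpos : Icc a b ⊆ Ioi 0 := fun s hs => ha.trans_le hs.1
  obtain ⟨C, hC⟩ := isCompact_Icc.exists_bound_of_continuousOn (continuousOn_coth.mono hpos)
  have hC0 : 0 ≤ C := (norm_nonneg _).trans (hC s₀ hs₀)
  set K : NNReal := ⟨|m| * C, by positivity⟩
  set T : NNReal := ⟨max (b - s₀) (s₀ - a), le_max_of_le_left (sub_nonneg.2 hs₀.2)⟩
  have hcoth : ∀ s ∈ Icc a b, |m * (Real.cosh s / Real.sinh s)| ≤ |m| * C := fun s hs => by
    rw [abs_mul]; exact mul_le_mul_of_nonneg_left (hC s hs) (abs_nonneg m)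
  -- The radius (1 + K) * T is the bound of the field times the longer side of the interval, so
  -- solutions cannot leave the ball before the endpoints.
  have hPL : IsPicardLindelof
      (fun s p => 1 - m * (Real.cosh s / Real.sinh s) * Real.tanh p) (⟨s₀, hs₀⟩ : Icc a b)
      (Real.artanh w₀) ((1 + K) * T) 0 (1 + K) K := by
    refine ⟨fun s hs => ?_, fun p _ => ?_, fun s hs p _ => ?_, ?_⟩
    · refine LipschitzOnWith.of_dist_le_mul fun p _ q _ => ?_
      have h1 := lipschitzWith_tanh.dist_le_mul q p
      rw [Real.dist_eq, NNReal.coe_one, one_mul] at h1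
      have : (1 - m * (Real.cosh s / Real.sinh s) * Real.tanh p) -
          (1 - m * (Real.cosh s / Real.sinh s) * Real.tanh q) =
          m * (Real.cosh s / Real.sinh s) * (Real.tanh q - Real.tanh p) := by ring
      rw [Real.dist_eq, this, abs_mul, dist_comm p q]
      exact mul_le_mul (hcoth s hs) h1 (abs_nonneg _) (by positivity)
    · have := continuousOn_coth.mono hpos
      fun_prop
    · rw [Real.norm_eq_abs]
      refine (abs_sub _ _).trans ?_
      rw [abs_one]
      have := mul_le_mul (hcoth s hs) (Real.abs_tanh_lt_one p).le (abs_nonneg _) (by positivity)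
      rw [mul_one] at this
      
      change 1 + |m * (Real.cosh s / Real.sinh s) * Real.tanh p| ≤ 1 + |m| * C
      rw [abs_mul]
      linarith
    · change (1 + |m| * C) * max (b - s₀) (s₀ - a) ≤ (1 + |m| * C) * max (b - s₀) (s₀ - a) - 0
      rw [sub_zero]
  obtain ⟨p, hp0, hp⟩ := hPL.exists_eq_forall_mem_Icc_hasDerivWithinAt₀
  refine ⟨fun s => Real.tanh (p s), ?_, fun s hs => ⟨Real.abs_tanh_lt_one _, ?_⟩⟩
  · simp only [hp0]
    exact Real.tanh_artanh (abs_lt.1 hw₀)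
  · have h := (hp s (Ioo_subset_Icc_self hs)).hasDerivAt (Icc_mem_nhds hs.1 hs.2)
    exact (hasDerivAt_tanh (p s)).comp s h

/-- The profile equation has global solutions. -/
theorem exists_slope (m : ℝ) {s₀ w₀ : ℝ} (hs₀ : 0 < s₀) (hw₀ : |w₀| < 1) :
    ∃ w : ℝ → ℝ, w s₀ = w₀ ∧ IsSlopeOn m w (Ioi 0) := by
  set a : ℝ → ℝ := fun s => min s s₀ / 2
  set b : ℝ → ℝ := fun s => max s s₀ + 1
  have ha : ∀ s, 0 < s → 0 < a s := fun s hs => half_pos (lt_min hs hs₀)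
  have h0 : ∀ s, 0 < s → s₀ ∈ Ioo (a s) (b s) := fun s hs =>
    ⟨by have := min_le_right s s₀; simp only [a]; linarith,
      by have := le_max_right s s₀; simp only [b]; linarith⟩
  have h1 : ∀ s, 0 < s → s ∈ Ioo (a s) (b s) := fun s hs =>
    ⟨by have := min_le_left s s₀; simp only [a]; linarith,
      by have := le_max_left s s₀; simp only [b]; linarith⟩
  have hex : ∀ s, ∃ w : ℝ → ℝ, 0 < s → w s₀ = w₀ ∧ IsSlopeOn m w (Ioo (a s) (b s)) := by
    intro s
    by_cases hs : 0 < s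
    · obtain ⟨w, hw⟩ := exists_slope_Ioo m (ha s hs) (Ioo_subset_Icc_self (h0 s hs)) hw₀
      exact ⟨w, fun _ => hw⟩
    · exact ⟨0, fun h => absurd h hs⟩
  choose v hv using hex
  -- All `v s` pass through (s₀, w₀), so by uniqueness they agree on overlaps and their diagonal
  -- values form one solution.
  refine ⟨fun s => v s s, (hv s₀ hs₀).1, ?_⟩
  intro s hs
  have hloc : ∀ t ∈ Ioo (a s) (b s), v t t = v s t := by
    intro t ht
    have ht0 : 0 < t := (ha s hs).trans ht.1
    have hsub : Ioo (a s) (b s) ∩ Ioo (a t) (b t) ⊆ Ioi 0 := fun r hr => (ha s hs).trans hr.1.1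
    exact IsSlopeOn.eqOn (isOpen_Ioo.inter isOpen_Ioo) (ordConnected_Ioo.inter ordConnected_Ioo)
      hsub ((hv t ht0).2.mono inter_subset_right) ((hv s hs).2.mono inter_subset_left)
      ⟨h0 s hs, h0 t ht0⟩ (by rw [(hv t ht0).1, (hv s hs).1]) ⟨ht, h1 t ht0⟩
  exact (hv s hs).2.congr isOpen_Ioo hloc s (h1 s hs)

/-! ### Behaviour of slopes as s tends to 0 -/

/-- A function that increases wherever it vanishes is negative before any point at which it is
nonpositive. -/
theorem neg_of_nonpos_of_deriv_pos {d d' : ℝ → ℝ} {I : Set ℝ} (hI : I.OrdConnected)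
    (hd : ∀ t ∈ I, HasDerivAt d (d' t) t) (hpos : ∀ t ∈ I, d t = 0 → 0 < d' t) {s s₁ : ℝ}
    (hs : s ∈ I) (hs₁ : s₁ ∈ I) (h : d s₁ ≤ 0) (hlt : s < s₁) : d s < 0 := by
  have hsub : Icc s s₁ ⊆ I := hI.out hs hs₁
  -- The barrier argument runs forward, so it is applied to x ↦ d(-x).
  have hneg : ∀ x ∈ Icc (-s₁) (-s), -x ∈ I := fun x hx =>
    hsub ⟨by linarith [hx.2], by linarith [hx.1]⟩
  have hd2 : ∀ x ∈ Icc (-s₁) (-s), HasDerivAt (fun x => d (-x)) (-d' (-x)) x := fun x hx => by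
    have := (hd _ (hneg x hx)).scomp x (hasDerivAt_neg x)
    exact this.congr_deriv (by simp)
  have hle : ∀ t ∈ Icc s s₁, d t ≤ 0 := by
    intro t ht
    have := image_le_of_deriv_right_lt_deriv_boundary (f := fun x => d (-x))
      (f' := fun x => -d' (-x)) (a := -s₁) (b := -s) (B := fun _ => 0) (B' := fun _ => 0)
      (fun x hx => (hd2 x hx).continuousAt.continuousWithinAt)
      (fun x hx => (hd2 x (Ico_subset_Icc_self hx)).hasDerivWithinAt) (by simpa using h)
      (fun x => hasDerivAt_const x 0)
      (fun x hx h0 => by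
        have := hpos _ (hneg x (Ico_subset_Icc_self hx)) h0
        linarith)
      (show -t ∈ Icc (-s₁) (-s) from ⟨by linarith [ht.2], by linarith [ht.1]⟩)
    simpa using this
  refine lt_of_le_of_ne (hle s (left_mem_Icc.2 hlt.le)) fun h0 => ?_
  have hsl := hasDerivAt_iff_tendsto_slope.1 (hd s hs)
  have h1 : ∀ᶠ t in 𝓝[>] s, 0 < slope d s t :=
    (hsl.mono_left (nhdsGT_le_nhdsNE s)).eventually (lt_mem_nhds (hpos s hs h0))
  obtain ⟨t, ht, ht2⟩ := (h1.and (Ioo_mem_nhdsGT hlt)).exists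
  rw [slope_def_field, h0, sub_zero] at ht
  have := (div_pos_iff_of_pos_right (sub_pos.2 ht2.1)).1 ht
  linarith [hle t (Ioo_subset_Icc_self ht2)]

/-- A function with `s v'(s) → -c < 0` tends to `∞` at `0`. -/
theorem not_bounded_of_tendsto_mul_deriv {v v' : ℝ → ℝ} {c M : ℝ} (hc : 0 < c)
    (hd : ∀ s, 0 < s → HasDerivAt v (v' s) s)
    (hlim : Tendsto (fun s => s * v' s) (𝓝[>] 0) (𝓝 (-c))) (hM : ∀ s, 0 < s → v s ≤ M) :
    False := by
  have hev : ∀ᶠ s in 𝓝[>] (0 : ℝ), s * v' s < -(c / 2) :=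
    hlim.eventually (gt_mem_nhds (by linarith))
  obtain ⟨δ, hδ, hδ'⟩ := (mem_nhdsGT_iff_exists_Ioo_subset).1 hev
  have hδ0 : 0 < δ := hδ
  have hg : ∀ s ∈ Ioo 0 δ, HasDerivAt (fun s => v s + c / 2 * Real.log s)
      (v' s + c / 2 * s⁻¹) s := fun s hs =>
    (hd s hs.1).add ((Real.hasDerivAt_log hs.1.ne').const_mul _)
  -- Near 0 the derivative of v lies below -c/(2s); hence v exceeds a constant minus (c/2) log s,
  -- which passes M.
  have hanti : AntitoneOn (fun s => v s + c / 2 * Real.log s) (Ioo 0 δ) := by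
    refine antitoneOn_of_deriv_nonpos (convex_Ioo 0 δ)
      (fun s hs => (hg s hs).continuousAt.continuousWithinAt) ?_ ?_
    · rw [interior_Ioo]
      exact fun s hs => (hg s hs).differentiableAt.differentiableWithinAt
    · rw [interior_Ioo]
      intro s hs
      have h1 : s * v' s < -(c / 2) := hδ' hs
      have h2 : s * (v' s + c / 2 * s⁻¹) ≤ 0 := by
        have : s * s⁻¹ = 1 := mul_inv_cancel₀ hs.1.ne'
        linear_combination h1.le + c / 2 * this
      rw [(hg s hs).deriv]
      exact nonpos_of_mul_nonpos_right h2 hs.1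
  have hb : ∀ᶠ s in 𝓝[>] (0 : ℝ),
      Real.log s < (v (δ / 2) + c / 2 * Real.log (δ / 2) - M) / (c / 2) :=
    Real.tendsto_log_nhdsGT_zero.eventually (eventually_lt_atBot _)
  obtain ⟨s, hs, hs2⟩ := (hb.and (Ioo_mem_nhdsGT (half_pos hδ0))).exists
  have h1 := hanti ⟨hs2.1, by linarith [hs2.2]⟩ ⟨half_pos hδ0, by linarith⟩ hs2.2.le
  rw [lt_div_iff₀ (by linarith)] at hs
  have := hM s hs2.1
  simp only at h1
  linarith

theorem tendsto_mul_coth : Tendsto (fun s => s * (Real.cosh s / Real.sinh s)) (𝓝[>] 0) (𝓝 1) := by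
  have h := hasDerivAt_iff_tendsto_slope.1 (Real.hasDerivAt_sinh 0)
  have h1 : Tendsto (fun s => Real.sinh s / s) (𝓝[>] 0) (𝓝 1) := by
    rw [Real.cosh_zero] at h
    refine (h.mono_left (nhdsGT_le_nhdsNE 0)).congr fun s => ?_
    simp [slope_def_field]
  have h2 : Tendsto Real.cosh (𝓝[>] 0) (𝓝 1) := by
    have := Real.continuous_cosh.tendsto 0
    rw [Real.cosh_zero] at this
    exact this.mono_left nhdsWithin_le_nhds
  have h3 := h2.div h1 one_ne_zero
  rw [div_one] at h3
  refine h3.congr fun s => ?_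
  simp only [Pi.div_apply]
  rw [div_div_eq_mul_div, mul_comm, mul_div_assoc]

section Slope

variable {m : ℝ} {w : ℝ → ℝ}

/-- The simple pole of coth at 0 dominates the field. For m ≠ 0 its leading coefficient vanishes
only for l = 0, 1, -1. -/
theorem tendsto_mul_slopeField {l : ℝ}
    (hl : Tendsto w (𝓝[>] 0) (𝓝 l)) :
    Tendsto (fun s => s * slopeField m s (w s)) (𝓝[>] 0) (𝓝 (-((1 - l ^ 2) * m * l))) := by
  have h0 : Tendsto (fun s : ℝ => s) (𝓝[>] 0) (𝓝 0) := tendsto_id.mono_left nhdsWithin_le_nhds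
  have := ((tendsto_const_nhds (x := (1 : ℝ))).sub (hl.pow 2)).mul
    (h0.sub ((tendsto_mul_coth.const_mul m).mul hl))
  convert this using 2
  · simp only [slopeField]; ring
  · ring

/-- If 0 < |l| < 1, then s w'(s) has a nonzero limit of sign opposite to l, and w or -w grows
logarithmically although |w| < 1. -/
theorem IsSlopeOn.abs_limit_eq_one (hm : 0 < m) (hw : IsSlopeOn m w (Ioi 0)) {l : ℝ}
    (hl : Tendsto w (𝓝[>] 0) (𝓝 l)) (h0 : l ≠ 0) : |l| = 1 := by
  have hle : |l| ≤ 1 := le_of_tendsto hl.abs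
    (eventually_mem_nhdsWithin.mono fun s hs => (hw s hs).1.le)
  by_contra hne
  have hlt : 0 < 1 - l ^ 2 := by
    rw [sub_pos, sq_lt_one_iff_abs_lt_one]; exact lt_of_le_of_ne hle hne
  have hlim := tendsto_mul_slopeField (m := m) hl
  rcases lt_or_gt_of_ne h0 with h | h
  · refine not_bounded_of_tendsto_mul_deriv (v := fun s => -w s) (M := 1)
      (c := (1 - l ^ 2) * m * (-l)) (by have := neg_pos.2 h; positivity)
      (fun s hs => (hw s hs).2.neg) ?_ (fun s hs => by linarith [(abs_lt.1 (hw s hs).1).1])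
    convert hlim.neg using 2 <;> ring
  · exact not_bounded_of_tendsto_mul_deriv (M := 1) (by positivity) (fun s hs => (hw s hs).2) hlim
      (fun s hs => (abs_lt.1 (hw s hs).1).2.le)

/-- Where w = 0 the field equals 1, so w ≤ 0 is a trap for decreasing s. -/
theorem IsSlopeOn.neg_of_nonpos (hw : IsSlopeOn m w (Ioi 0)) {s s₁ : ℝ} (hs : 0 < s)
    (h : w s₁ ≤ 0) (hlt : s < s₁) : w s < 0 :=
  neg_of_nonpos_of_deriv_pos ordConnected_Ioi (fun t ht => (hw t ht).2)
    (fun t _ h0 => by simp [slopeField, h0]) hs (hs.trans hlt) h hlt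

/-- The curve tanh s / m is the nullcline. It rises while solutions crossing it are stationary, so
the region above it is the second trap. -/
theorem IsSlopeOn.tanh_lt_of_le (hm : 0 < m) (hw : IsSlopeOn m w (Ioi 0)) {s s₁ : ℝ} (hs : 0 < s)
    (h : Real.tanh s₁ / m ≤ w s₁) (hlt : s < s₁) : Real.tanh s / m < w s := by
  have := neg_of_nonpos_of_deriv_pos (d := fun t => Real.tanh t / m - w t)
    (d' := fun t => (1 - Real.tanh t ^ 2) / m - slopeField m t (w t)) (I := Ioi 0) ordConnected_Ioi
    (fun t ht => ((hasDerivAt_tanh t).div_const m).sub (hw t ht).2) (fun t ht h0 => ?_)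
    hs (hs.trans hlt) (sub_nonpos.2 h) hlt
  · linarith
  · have hsinh : Real.sinh t ≠ 0 := (Real.sinh_pos_iff.2 ht).ne'
    have hcosh : Real.cosh t ≠ 0 := (Real.cosh_pos t).ne'
    have hwt : w t = Real.tanh t / m := by linarith
    have h1 : slopeField m t (w t) = 0 := by
      rw [slopeField, hwt, Real.tanh_eq_sinh_div_cosh]
      field_simp
      ring
    simp only [h1, sub_zero]
    have := Real.abs_tanh_lt_one t
    rw [← sq_lt_one_iff_abs_lt_one] at this
    exact div_pos (by linarith) hm

/-- Inside the trap both factors of the field are positive, so w is monotone and has a negative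
limit at 0; only -1 is possible. -/
theorem IsSlopeOn.tendsto_neg_one (hm : 0 < m) (hw : IsSlopeOn m w (Ioi 0)) {s₁ : ℝ}
    (hs₁ : 0 < s₁) (h : w s₁ ≤ 0) : Tendsto w (𝓝[>] 0) (𝓝 (-1)) := by
  have hmono : MonotoneOn w (Ioo 0 s₁) := by
    refine monotoneOn_of_deriv_nonneg (convex_Ioo 0 s₁)
      (hw.continuousOn.mono Ioo_subset_Ioi_self) ?_ ?_
    · rw [interior_Ioo]
      exact fun s hs => (hw s hs.1).2.differentiableAt.differentiableWithinAt
    · rw [interior_Ioo]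
      intro s hs
      rw [(hw s hs.1).2.deriv, slopeField]
      have h1 := hw.neg_of_nonpos hs.1 h hs.2
      have h2 := (sq_lt_one_iff_abs_lt_one _).2 (hw s hs.1).1
      have h3 := one_lt_coth hs.1
      have : 0 ≤ m * (Real.cosh s / Real.sinh s) * (-w s) := by
        have := neg_pos.2 h1; positivity
      exact mul_nonneg (by linarith) (by linarith)
  have hbdd : BddBelow (w '' Ioo 0 s₁) := ⟨-1, by
    rintro _ ⟨s, hs, rfl⟩
    exact (abs_lt.1 (hw s hs.1).1).1.le⟩
  have hlim := hmono.tendsto_nhdsWithin_Ioo_right (nonempty_Ioo.2 hs₁) hbdd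
  have hneg : sInf (w '' Ioo 0 s₁) < 0 := by
    have hs2 : s₁ / 2 ∈ Ioo 0 s₁ := ⟨by linarith, by linarith⟩
    exact (csInf_le hbdd (mem_image_of_mem w hs2)).trans_lt (hw.neg_of_nonpos hs2.1 h hs2.2)
  have h1 := hw.abs_limit_eq_one hm hlim hneg.ne
  rw [abs_of_neg hneg] at h1
  rw [← h1, neg_neg]
  exact hlim

/-- Above the nullcline w decreases in s and stays positive, so its limit at 0 is positive and hence
1. The limit is taken for -w, which is monotone. -/
theorem IsSlopeOn.tendsto_one (hm : 0 < m) (hw : IsSlopeOn m w (Ioi 0)) {s₁ : ℝ}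
    (hs₁ : 0 < s₁) (h : Real.tanh s₁ / m ≤ w s₁) : Tendsto w (𝓝[>] 0) (𝓝 1) := by
  have hanti : AntitoneOn w (Ioo 0 s₁) := by
    refine antitoneOn_of_deriv_nonpos (convex_Ioo 0 s₁)
      (hw.continuousOn.mono Ioo_subset_Ioi_self) ?_ ?_
    · rw [interior_Ioo]
      exact fun s hs => (hw s hs.1).2.differentiableAt.differentiableWithinAt
    · rw [interior_Ioo]
      intro s hs
      rw [(hw s hs.1).2.deriv, slopeField]
      have h1 := hw.tanh_lt_of_le hm hs.1 h hs.2
      have h2 := (sq_lt_one_iff_abs_lt_one _).2 (hw s hs.1).1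
      have hsinh := Real.sinh_pos_iff.2 hs.1
      have hcosh := Real.cosh_pos s
      rw [Real.tanh_eq_sinh_div_cosh, div_div, div_lt_iff₀ (by positivity)] at h1
      refine mul_nonpos_of_nonneg_of_nonpos (by linarith) (sub_nonpos.2 ?_)
      rw [mul_div_assoc', div_mul_eq_mul_div, one_le_div hsinh]
      linarith
  have hbdd : BddBelow ((fun s => -w s) '' Ioo 0 s₁) := ⟨-1, by
    rintro _ ⟨s, hs, rfl⟩
    exact neg_le_neg (abs_lt.1 (hw s hs.1).1).2.le⟩
  have hlim := hanti.neg.tendsto_nhdsWithin_Ioo_right (nonempty_Ioo.2 hs₁) hbdd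
  have hneg : sInf ((fun s => -w s) '' Ioo 0 s₁) < 0 := by
    have hs2 : s₁ / 2 ∈ Ioo 0 s₁ := ⟨by linarith, by linarith⟩
    refine (csInf_le hbdd (mem_image_of_mem _ hs2)).trans_lt (neg_lt_zero.2 ?_)
    refine lt_trans ?_ (hw.tanh_lt_of_le hm hs2.1 h hs2.2)
    rw [Real.tanh_eq_sinh_div_cosh]
    have := Real.sinh_pos_iff.2 hs2.1
    have := Real.cosh_pos (s₁ / 2)
    positivity
  have hlim' := hlim.neg
  simp only [neg_neg] at hlim'
  have h1 := hw.abs_limit_eq_one hm hlim' (neg_pos.2 hneg).ne'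
  rw [abs_of_pos (neg_pos.2 hneg)] at h1
  rw [h1] at hlim'
  exact hlim'

theorem tendsto_tanh_div (m : ℝ) : Tendsto (fun s => Real.tanh s / m) (𝓝[>] 0) (𝓝 0) := by
  have h := ((hasDerivAt_tanh 0).continuousAt.div_const m).tendsto
  rw [Real.tanh_zero, zero_div] at h
  exact h.mono_left nhdsWithin_le_nhds

theorem IsSlopeOn.tendsto_zero (h : ∀ s, 0 < s → 0 < w s ∧ w s < Real.tanh s / m) :
    Tendsto w (𝓝[>] 0) (𝓝 0) :=
  tendsto_of_tendsto_of_tendsto_of_le_of_le' tendsto_const_nhds (tendsto_tanh_div m)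
    (eventually_mem_nhdsWithin.mono fun s hs => (h s hs).1.le)
    (eventually_mem_nhdsWithin.mono fun s hs => (h s hs).2.le)

theorem IsSlopeOn.bounds_of_tendsto_zero (hm : 0 < m) (hw : IsSlopeOn m w (Ioi 0))
    (h : Tendsto w (𝓝[>] 0) (𝓝 0)) {s : ℝ} (hs : 0 < s) : 0 < w s ∧ w s < Real.tanh s / m := by
  constructor
  · by_contra! hle
    have := tendsto_nhds_unique h (hw.tendsto_neg_one hm hs hle)
    norm_num at this
  · by_contra! hle
    have := tendsto_nhds_unique h (hw.tendsto_one hm hs hle)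
    norm_num at this

theorem IsSlopeOn.trichotomy (hm : 0 < m) (hw : IsSlopeOn m w (Ioi 0)) :
    Tendsto w (𝓝[>] 0) (𝓝 0) ∨ Tendsto w (𝓝[>] 0) (𝓝 1) ∨ Tendsto w (𝓝[>] 0) (𝓝 (-1)) := by
  by_cases h1 : ∃ s, 0 < s ∧ w s ≤ 0
  · obtain ⟨s, hs, h⟩ := h1
    exact .inr (.inr (hw.tendsto_neg_one hm hs h))
  by_cases h2 : ∃ s, 0 < s ∧ Real.tanh s / m ≤ w s
  · obtain ⟨s, hs, h⟩ := h2
    exact .inr (.inl (hw.tendsto_one hm hs h))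
  push Not at h1 h2
  exact .inl (IsSlopeOn.tendsto_zero fun s hs => ⟨h1 s hs, h2 s hs⟩)

/-- For small solutions the coth term makes v - w decrease in s. A positive difference could then
not tend to 0 at s = 0. -/
theorem IsSlopeOn.not_lt_of_tendsto_zero (hm : 0 < m) {v : ℝ → ℝ} (hw : IsSlopeOn m w (Ioi 0))
    (hv : IsSlopeOn m v (Ioi 0)) (hw0 : Tendsto w (𝓝[>] 0) (𝓝 0)) (hv0 : Tendsto v (𝓝[>] 0) (𝓝 0))
    {s : ℝ} (hs : 0 < s) : ¬ w s < v s := by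
  intro hlt
  have hlt' : ∀ t, 0 < t → w t < v t := fun t ht =>
    hw.lt isOpen_Ioi ordConnected_Ioi Subset.rfl hv hs hlt ht
  have hlim : Tendsto (fun t => v t ^ 2 + v t * w t + w t ^ 2) (𝓝[>] 0) (𝓝 0) := by
    simpa using ((hv0.pow 2).add (hv0.mul hw0)).add (hw0.pow 2)
  obtain ⟨δ, hδ, hδ'⟩ :=
    (mem_nhdsGT_iff_exists_Ioo_subset).1 (hlim.eventually (gt_mem_nhds zero_lt_one))
  have hδ0 : 0 < δ := hδ
  have hanti : AntitoneOn (fun t => v t - w t) (Ioo 0 δ) := by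
    refine antitoneOn_of_deriv_nonpos (convex_Ioo 0 δ)
      ((hv.continuousOn.sub hw.continuousOn).mono Ioo_subset_Ioi_self) ?_ ?_
    · rw [interior_Ioo]
      exact fun t ht =>
        ((hv t ht.1).2.sub (hw t ht.1).2).differentiableAt.differentiableWithinAt
    · rw [interior_Ioo]
      intro t ht
      have hder : deriv (fun t => v t - w t) t = _ := ((hv t ht.1).2.sub (hw t ht.1).2).deriv
      rw [hder]
      have h1 := hlt' t ht.1
      have h2 : v t ^ 2 + v t * w t + w t ^ 2 < 1 := hδ' ht
      have h3 := (hw.bounds_of_tendsto_zero hm hw0 ht.1).1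
      have h4 := one_lt_coth ht.1
      have h5 : 0 ≤ m * (Real.cosh t / Real.sinh t) * (1 - (v t ^ 2 + v t * w t + w t ^ 2)) := by
        have := sub_pos.2 h2
        positivity
      have : slopeField m t (v t) - slopeField m t (w t) = -((v t - w t) * (v t + w t +
          m * (Real.cosh t / Real.sinh t) * (1 - (v t ^ 2 + v t * w t + w t ^ 2)))) := by
        simp only [slopeField]; ring
      rw [this]
      exact neg_nonpos.2 (mul_nonneg (by linarith) (by linarith))
  have hpos : 0 < v (δ / 2) - w (δ / 2) := sub_pos.2 (hlt' _ (half_pos hδ0))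
  have hge : v (δ / 2) - w (δ / 2) ≤ 0 - 0 := by
    refine ge_of_tendsto (hv0.sub hw0) ?_
    filter_upwards [Ioo_mem_nhdsGT (half_pos hδ0)] with t ht
    exact hanti ⟨ht.1, by linarith [ht.2]⟩ ⟨half_pos hδ0, by linarith⟩ ht.2.le
  linarith

theorem IsSlopeOn.eqOn_of_tendsto_zero (hm : 0 < m) {v : ℝ → ℝ} (hw : IsSlopeOn m w (Ioi 0))
    (hv : IsSlopeOn m v (Ioi 0)) (hw0 : Tendsto w (𝓝[>] 0) (𝓝 0))
    (hv0 : Tendsto v (𝓝[>] 0) (𝓝 0)) : EqOn w v (Ioi 0) := fun _ hs =>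
  le_antisymm (not_lt.1 (hv.not_lt_of_tendsto_zero hm hw hv0 hw0 hs))
    (not_lt.1 (hw.not_lt_of_tendsto_zero hm hv hw0 hv0 hs))

theorem tanh_div_mem (hm : 1 ≤ m) {s : ℝ} (hs : 0 < s) :
    0 < Real.tanh s / m ∧ |Real.tanh s / m| < 1 := by
  have h1 : 0 < Real.tanh s := by
    rw [Real.tanh_eq_sinh_div_cosh]
    exact div_pos (Real.sinh_pos_iff.2 hs) (Real.cosh_pos s)
  have hm0 : 0 < m := by linarith
  refine ⟨div_pos h1 hm0, ?_⟩
  rw [abs_div, abs_of_pos hm0, div_lt_one hm0]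
  exact (Real.abs_tanh_lt_one s).trans_le hm

/-- Shooting from s = 1: the wanted solution takes there the supremum of the values of solutions
that fall into the trap w ≤ 0, and it avoids both traps because each is entered on an open set of
data. -/
theorem exists_slope_tendsto_zero (hm : 1 ≤ m) :
    ∃ w, IsSlopeOn m w (Ioi 0) ∧ Tendsto w (𝓝[>] 0) (𝓝 0) := by
  have hm0 : 0 < m := by linarith
  set A : Set ℝ := {a | ∃ v, IsSlopeOn m v (Ioi 0) ∧ v 1 = a ∧ ∃ s ∈ Ioc (0 : ℝ) 1, v s ≤ 0}
  have hA0 : (0 : ℝ) ∈ A := by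
    obtain ⟨v, hv1, hv⟩ := exists_slope m one_pos (w₀ := 0) (by simp)
    exact ⟨v, hv, hv1, 1, by simp, hv1.le⟩
  have hAb : ∀ a ∈ A, a ≤ Real.tanh 1 / m := by
    rintro _ ⟨v, hv, rfl, s, hs, h⟩
    by_contra! hlt
    rcases hs.2.eq_or_lt with rfl | hs1
    · linarith [(tanh_div_mem hm one_pos).1]
    · linarith [hv.tanh_lt_of_le hm0 hs.1 hlt.le hs1, (tanh_div_mem hm hs.1).1]
  have hbdd : BddAbove A := ⟨_, hAb⟩
  have h0 : 0 ≤ sSup A := le_csSup hbdd hA0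
  have h1 : sSup A < 1 :=
    (csSup_le ⟨0, hA0⟩ hAb).trans_lt (abs_lt.1 (tanh_div_mem hm one_pos).2).2
  obtain ⟨w, hw1, hw⟩ := exists_slope m one_pos (w₀ := sSup A) (by rwa [abs_of_nonneg h0])
  refine ⟨w, hw, IsSlopeOn.tendsto_zero (m := m) fun s₁ hs₁ => ?_⟩
  -- Being strictly before s₁ makes the trap inequalities strict at s; being below 1 keeps s in the
  -- range used by `A`.
  set s := min s₁ 1 / 2
  have hs : 0 < s := half_pos (lt_min hs₁ one_pos)
  have hss₁ : s < s₁ := (half_lt_self (lt_min hs₁ one_pos)).trans_le (min_le_left _ _)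
  have hs1 : s < 1 := (half_lt_self (lt_min hs₁ one_pos)).trans_le (min_le_right _ _)
  constructor
  · by_contra! hle
    have hws := hw.neg_of_nonpos hs hle hss₁
    -- The solution vanishing at s stays above w, so its value at 1 lies in `A` and exceeds the
    -- supremum.
    obtain ⟨v, hvs, hv⟩ := exists_slope m hs (w₀ := 0) (by simp)
    have hlt := hw.lt isOpen_Ioi ordConnected_Ioi Subset.rfl hv hs (hvs ▸ hws)
      (mem_Ioi.2 one_pos)
    have : v 1 ≤ sSup A := le_csSup hbdd ⟨v, hv, rfl, s, ⟨hs, hs1.le⟩, hvs.le⟩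
    linarith
  · by_contra! hle
    have hws := hw.tanh_lt_of_le hm0 hs hle hss₁
    -- The solution starting on the nullcline stays below w, hence below some u from `A`. It is then
    -- in both traps near 0, which is absurd.
    obtain ⟨v, hvs, hv⟩ := exists_slope m hs (tanh_div_mem hm hs).2
    have hlt := hv.lt isOpen_Ioi ordConnected_Ioi Subset.rfl hw hs (hvs ▸ hws)
      (mem_Ioi.2 one_pos)
    rw [hw1] at hlt
    obtain ⟨_, ⟨u, hu, rfl, r, hr, hur⟩, hlt'⟩ := exists_lt_of_lt_csSup ⟨0, hA0⟩ hlt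
    have hvu : ∀ t, 0 < t → v t < u t := fun t ht =>
      hv.lt isOpen_Ioi ordConnected_Ioi Subset.rfl hu (mem_Ioi.2 one_pos) hlt' ht
    have hvr : v r ≤ 0 := (hvu r hr.1).le.trans hur
    set t := min r s / 2
    have ht : 0 < t := half_pos (lt_min hr.1 hs)
    have htr : t < r := (half_lt_self (lt_min hr.1 hs)).trans_le (min_le_left _ _)
    have hts : t < s := (half_lt_self (lt_min hr.1 hs)).trans_le (min_le_right _ _)
    linarith [hv.neg_of_nonpos ht hvr htr, hv.tanh_lt_of_le hm0 ht hvs.ge hts,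
      (tanh_div_mem hm ht).1]

theorem exists_slope_tendsto_one (hm : 1 ≤ m) :
    ∃ w, IsSlopeOn m w (Ioi 0) ∧ Tendsto w (𝓝[>] 0) (𝓝 1) := by
  obtain ⟨w, hw1, hw⟩ := exists_slope m one_pos (tanh_div_mem hm one_pos).2
  exact ⟨w, hw, hw.tendsto_one (by linarith) one_pos hw1.ge⟩

theorem exists_slope_tendsto_neg_one (hm : 1 ≤ m) :
    ∃ w, IsSlopeOn m w (Ioi 0) ∧ Tendsto w (𝓝[>] 0) (𝓝 (-1)) := by
  obtain ⟨w, hw1, hw⟩ := exists_slope m one_pos (w₀ := 0) (by simp)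
  exact ⟨w, hw, hw.tendsto_neg_one (by linarith) one_pos hw1.le⟩

end Slope

/-! ### Profiles recovered from slopes -/

theorem IsProfile.isSlopeOn {n : ℕ} {f w : ℝ → ℝ} (h : IsProfile n f w) :
    IsSlopeOn ((n : ℝ) - 1) w (Ioi 0) := fun s hs => ⟨h.abs_lt_one s hs, h.ode s hs⟩

/-- The profile with given slope through a given point. -/
theorem IsSlopeOn.exists_isProfile {n : ℕ} {w : ℝ → ℝ} (hw : IsSlopeOn ((n : ℝ) - 1) w (Ioi 0))
    {s₀ : ℝ} (hs₀ : 0 ≤ s₀) (t₀ : ℝ) : ∃ f, f s₀ = t₀ ∧ IsProfile n f w := by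
  -- The bound |w| < 1 gives integrability up to 0, whatever the behaviour of w there.
  have hint : ∀ b, 0 ≤ b → IntervalIntegrable w MeasureTheory.volume 0 b := by
    intro b hb
    rw [intervalIntegrable_iff_integrableOn_Ioc_of_le hb]
    have hm : MeasureTheory.AEStronglyMeasurable w (MeasureTheory.volume.restrict (Ioc 0 b)) :=
      (hw.continuousOn.mono Ioc_subset_Ioi_self).aestronglyMeasurable measurableSet_Ioc
    refine MeasureTheory.IntegrableOn.of_bound (C := 1) (by simp) hm ?_
    exact (MeasureTheory.ae_restrict_mem measurableSet_Ioc).mono fun s hs => (hw s hs.1).1.le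
  refine ⟨fun s => t₀ + ∫ r in s₀..s, w r, by simp, fun s hs => ?_, fun s hs => ?_,
    fun s hs => (hw s hs).1, fun s hs => (hw s hs).2⟩
  · have hb : 0 ≤ max s s₀ + 1 := add_nonneg (le_max_of_le_left hs) zero_le_one
    have h := intervalIntegral.continuousOn_primitive_interval' (hint _ hb)
      (show s₀ ∈ uIcc 0 (max s s₀ + 1) by
        rw [uIcc_of_le hb]; exact ⟨hs₀, by linarith [le_max_right s s₀]⟩)
    rw [uIcc_of_le hb] at h
    have hlt : s < max s s₀ + 1 := (le_max_left s s₀).trans_lt (lt_add_one _)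
    exact continuousWithinAt_const.add ((h s ⟨hs, hlt.le⟩).mono_of_mem_nhdsWithin
      (inter_mem self_mem_nhdsWithin (mem_nhdsWithin_of_mem_nhds (Iic_mem_nhds hlt))))
  · refine (intervalIntegral.integral_hasDerivAt_right ((hint s₀ hs₀).symm.trans (hint s hs.le))
      (hw.continuousOn.stronglyMeasurableAtFilter isOpen_Ioi s hs)
      (hw s hs).2.continuousAt).const_add t₀

theorem IsProfile.exists_add_const {n : ℕ} {f₁ w₁ f₂ w₂ : ℝ → ℝ} (h₁ : IsProfile n f₁ w₁)
    (h₂ : IsProfile n f₂ w₂) (h : EqOn w₁ w₂ (Ioi 0)) : ∃ c, ∀ s, 0 ≤ s → f₂ s = f₁ s + c := by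
  have hd : ∀ s ∈ Ioi (0 : ℝ), HasDerivAt (fun s => f₂ s - f₁ s) 0 s := fun s hs => by
    refine ((h₂.hasDerivAt s hs).sub (h₁.hasDerivAt s hs)).congr_deriv ?_
    rw [h hs, sub_self]
  have hconst : EqOn (fun s => f₂ s - f₁ s) (fun _ => f₂ 1 - f₁ 1) (Ioi 0) := fun s hs =>
    isOpen_Ioi.is_const_of_deriv_eq_zero isPreconnected_Ioi
      (fun t ht => (hd t ht).differentiableAt.differentiableWithinAt)
      (fun t ht => (hd t ht).deriv) hs (mem_Ioi.2 one_pos)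
  have := hconst.of_subset_closure (h₂.continuousOn.sub h₁.continuousOn) continuousOn_const
    Ioi_subset_Ici_self (by rw [closure_Ioi])
  exact ⟨f₂ 1 - f₁ 1, fun s hs => by have := this (mem_Ici.2 hs); simp only at this; linarith⟩

/-- Unique continuation: agreement on an interval gives equal slopes at one point, and the slope
equation carries this to all of (0, ∞). -/
theorem IsProfile.eqOn {n : ℕ} {f₁ w₁ f₂ w₂ : ℝ → ℝ} (h₁ : IsProfile n f₁ w₁)
    (h₂ : IsProfile n f₂ w₂) {a b : ℝ} (ha : 0 ≤ a) (hab : a < b) (h : EqOn f₁ f₂ (Ioo a b)) :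
    EqOn f₁ f₂ (Ici 0) ∧ EqOn w₁ w₂ (Ioi 0) := by
  have hc : (a + b) / 2 ∈ Ioo a b := ⟨by linarith, by linarith⟩
  have hc0 : 0 < (a + b) / 2 := by linarith
  have hd := (h₁.hasDerivAt _ hc0).unique
    ((h₂.hasDerivAt _ hc0).congr_of_eventuallyEq (h.eventuallyEq_of_mem (isOpen_Ioo.mem_nhds hc)))
  have hw := h₁.isSlopeOn.eqOn isOpen_Ioi ordConnected_Ioi Subset.rfl h₂.isSlopeOn hc0 hd
  obtain ⟨c, hc'⟩ := h₁.exists_add_const h₂ hw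
  refine ⟨fun s hs => ?_, hw⟩
  have h1 := hc' _ hc0.le
  rw [h hc] at h1
  rw [hc' s hs]
  linarith

/-! ### Geometry of radial graphs over the space coordinates -/

variable {n : ℕ}

/-- The time-like coordinate of the point of `ℍⁿ` above `y`. -/
noncomputable def height (y : E n) : ℝ := √(1 + ‖y‖ ^ 2)

/-- The graph of `u` over `ℍⁿ`, parametrized by the space coordinates. -/
noncomputable def graphMap (u : E n → ℝ) (y : E n) : Ambient n := ((y, height y), u y)

/-- The differential of `u` at `y` is `p⟨y, ·⟩`. -/
def HasRadialDerivAt (u : E n → ℝ) (p : ℝ) (y : E n) : Prop :=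
  HasFDerivAt u (p • innerSL ℝ y) y

theorem height_sq (y : E n) : height y ^ 2 = 1 + ‖y‖ ^ 2 := Real.sq_sqrt (by positivity)

theorem height_pos (y : E n) : 0 < height y := Real.sqrt_pos.2 (by positivity)

theorem hasRadialDerivAt_norm_sq (y : E n) : HasRadialDerivAt (fun y => ‖y‖ ^ 2) 2 y := by
  refine (hasStrictFDerivAt_norm_sq y).hasFDerivAt.congr_fderiv ?_
  ext v
  simp

/-- A function of `‖y‖²` has radial derivative. -/
theorem hasRadialDerivAt_comp_norm_sq {b : ℝ → ℝ} {b' : ℝ} {y : E n}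
    (hb : HasDerivAt b b' (‖y‖ ^ 2)) : HasRadialDerivAt (fun y => b (‖y‖ ^ 2)) (2 * b') y := by
  have h := hb.comp_hasFDerivAt y (hasRadialDerivAt_norm_sq y)
  rw [smul_smul, mul_comm] at h
  exact h

theorem hasRadialDerivAt_height (y : E n) : HasRadialDerivAt height (1 / height y) y := by
  have hpos := height_pos y
  have h : HasDerivAt (fun z => √(1 + z)) (1 / (2 * √(1 + ‖y‖ ^ 2))) (‖y‖ ^ 2) :=
    ((hasDerivAt_id' (‖y‖ ^ 2)).const_add 1).sqrt (by positivity)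
  have h2 := hasRadialDerivAt_comp_norm_sq h
  rw [show (2 * (1 / (2 * √(1 + ‖y‖ ^ 2)))) = 1 / height y by rw [height]; field_simp] at h2
  exact h2

theorem hasRadialDerivAt_inv_height (y : E n) :
    HasRadialDerivAt (fun y => 1 / height y) (-(1 / height y ^ 3)) y := by
  have hpos := height_pos y
  have h := (hasDerivAt_inv hpos.ne').comp_hasFDerivAt y (hasRadialDerivAt_height y)
  rw [smul_smul] at h
  rw [show (fun y : E n => 1 / height y) = (fun t => t⁻¹) ∘ height from
    funext fun x => one_div _]
  refine h.congr_fderiv ?_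
  congr 1
  field_simp

theorem contDiff_height {k : WithTop ℕ∞} : ContDiff ℝ k (height (n := n)) :=
  ContDiff.sqrt (contDiff_const.add (contDiff_norm_sq ℝ)) fun y => by positivity

theorem hasFDerivAt_graphMap {u : E n → ℝ} {u' : E n →L[ℝ] ℝ} {y : E n}
    (h : HasFDerivAt u u' y) : HasFDerivAt (graphMap u)
      (((ContinuousLinearMap.id ℝ (E n)).prod ((1 / height y) • innerSL ℝ y)).prod u') y :=
  ((hasFDerivAt_id y).prodMk (hasRadialDerivAt_height y)).prodMk h

theorem HasRadialDerivAt.fderiv_graphMap {u : E n → ℝ} {p : ℝ} {y : E n}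
    (h : HasRadialDerivAt u p y) (v : E n) : fderiv ℝ (graphMap u) y v =
      ((v, 1 / height y * inner ℝ y v), p * inner ℝ y v) := by
  rw [(hasFDerivAt_graphMap h).fderiv]
  simp

theorem inner_basisVec (y : E n) (i : Fin n) : inner ℝ y (basisVec i) = y i := by
  simp [basisVec, EuclideanSpace.inner_single_right]

theorem HasRadialDerivAt.mul_coord {P : E n → ℝ} {q : ℝ} {y : E n}
    (h : HasRadialDerivAt P q y) (j : Fin n) :
    HasFDerivAt (fun y => P y * y j)
      (P y • (EuclideanSpace.proj j : E n →L[ℝ] ℝ) + y j • (q • innerSL ℝ y)) y :=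
  HasFDerivAt.mul h (EuclideanSpace.proj j : E n →L[ℝ] ℝ).hasFDerivAt

/-- If du = P⟨y, ·⟩ and dP = q⟨y, ·⟩, the Hessian is P times the identity plus q y yᵀ. The height
has the same form with 1/h and -1/h³. -/
theorem pd₂_graphMap {u P : E n → ℝ} {q : ℝ} {y : E n}
    (hP : ∀ᶠ x in 𝓝 y, HasRadialDerivAt u (P x) x) (hq : HasRadialDerivAt P q y) (i j : Fin n) :
    pd₂ (graphMap u) i j y =
      ((0, 1 / height y * (if i = j then 1 else 0) + -(1 / height y ^ 3) * (y i * y j)),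
        P y * (if i = j then 1 else 0) + q * (y i * y j)) := by
  have hev : pd (graphMap u) j =ᶠ[𝓝 y] fun x =>
      ((basisVec j, 1 / height x * x j), P x * x j) := by
    filter_upwards [hP] with x hx
    rw [pd, hx.fderiv_graphMap, inner_basisVec]
  have hd := ((hasFDerivAt_const (basisVec j : E n) y).prodMk
    ((hasRadialDerivAt_inv_height y).mul_coord j)).prodMk (hq.mul_coord j)
  rw [pd₂, (hd.congr_of_eventuallyEq hev).fderiv]
  have hb : (basisVec i : E n) j = if i = j then 1 else 0 := by
    simp [basisVec, eq_comm]
  simp [inner_basisVec, hb]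
  constructor <;> ring

theorem inducedMetric_graphMap {u : E n → ℝ} {p : ℝ} {y : E n} (h : HasRadialDerivAt u p y) :
    inducedMetric (graphMap u) y =
      1 - (1 / height y ^ 2 + p ^ 2) • Matrix.vecMulVec (fun i => y i) (fun i => y i) := by
  ext i j
  have hb : (basisVec i : E n) j = if i = j then 1 else 0 := by
    simp [basisVec, eq_comm]
  simp only [inducedMetric, pd, Matrix.of_apply, h.fderiv_graphMap, g, lor, inner_basisVec, hb,
    Matrix.sub_apply, Matrix.smul_apply, Matrix.vecMulVec_apply, Matrix.one_apply, smul_eq_mul]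
  ring

theorem sum_coord_mul_self (y : E n) : ∑ i, y i * y i = ‖y‖ ^ 2 := by
  rw [EuclideanSpace.real_norm_sq_eq]
  simp [sq]

/-- The Sherman–Morrison formula; 1 - c|y|² is the determinant of the matrix. -/
theorem inv_one_sub_smul_vecMulVec (y : E n) {c : ℝ} (hc : 1 - c * ‖y‖ ^ 2 ≠ 0) :
    (1 - c • Matrix.vecMulVec (fun i => y i) (fun i => y i))⁻¹ =
      1 + (c / (1 - c * ‖y‖ ^ 2)) • Matrix.vecMulVec (fun i => y i) (fun i => y i) := by
  apply Matrix.inv_eq_right_inv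
  have hmul : Matrix.vecMulVec (fun i => y i) (fun i => y i) *
      Matrix.vecMulVec (fun i => y i) (fun i => y i) =
      ‖y‖ ^ 2 • Matrix.vecMulVec (fun i => y i) (fun i => y i) := by
    rw [Matrix.vecMulVec_mul_vecMulVec, dotProduct, sum_coord_mul_self]
    simp [Matrix.vecMulVec_smul]
  simp only [sub_mul, mul_add, one_mul, mul_one, smul_mul_assoc, mul_smul_comm, hmul, smul_smul]
  set M := Matrix.vecMulVec (fun i => y i) (fun i => y i)
  have : (c / (1 - c * ‖y‖ ^ 2)) - (c + c * (c / (1 - c * ‖y‖ ^ 2)) * ‖y‖ ^ 2) = 0 := by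
    field_simp; ring
  rw [show 1 - c • M + (c / (1 - c * ‖y‖ ^ 2)) • (M - (c * ‖y‖ ^ 2) • M) =
    1 + ((c / (1 - c * ‖y‖ ^ 2)) - (c + c * (c / (1 - c * ‖y‖ ^ 2)) * ‖y‖ ^ 2)) • M by module,
    this, zero_smul, add_zero]

theorem sum_one_add_vecMulVec_mul (y : E n) (k p q : ℝ) :
    ∑ i, ∑ j, (1 + k • Matrix.vecMulVec (fun i => y i) (fun i => y i) : Matrix _ _ ℝ) i j *
      (p * (if i = j then 1 else 0) + q * (y i * y j)) =
      n * p + (q + k * p) * ‖y‖ ^ 2 + k * q * (‖y‖ ^ 2) ^ 2 := by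
  have h1 : ∀ i j, (1 + k • Matrix.vecMulVec (fun i => y i) (fun i => y i) : Matrix _ _ ℝ) i j *
      (p * (if i = j then 1 else 0) + q * (y i * y j)) =
      (if i = j then p + (q + k * p) * (y i * y i) else 0) +
        k * q * ((y i * y i) * (y j * y j)) := by
    intro i j
    simp only [Matrix.add_apply, Matrix.one_apply, Matrix.smul_apply, Matrix.vecMulVec_apply,
      smul_eq_mul]
    split_ifs with h
    · subst h; ring
    · ring
  simp only [h1, Finset.sum_add_distrib, Finset.sum_ite_eq, Finset.mem_univ, if_true,
    ← Finset.mul_sum, sum_coord_mul_self, ← Finset.sum_mul]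
  rw [Finset.sum_const, Finset.card_univ, Fintype.card_fin, nsmul_eq_mul]
  ring

/-- The trace of the second derivatives of a rotationally symmetric graph. -/
theorem trace_pd₂_graphMap {u P : E n → ℝ} {q k : ℝ} {y : E n}
    (hP : ∀ᶠ x in 𝓝 y, HasRadialDerivAt u (P x) x) (hq : HasRadialDerivAt P q y)
    (hD : 1 - (1 / height y ^ 2 + P y ^ 2) * ‖y‖ ^ 2 ≠ 0)
    (hk : k = (1 / height y ^ 2 + P y ^ 2) / (1 - (1 / height y ^ 2 + P y ^ 2) * ‖y‖ ^ 2)) :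
    ∑ i, ∑ j, (inducedMetric (graphMap u) y)⁻¹ i j • pd₂ (graphMap u) i j y =
      ((0, n * (1 / height y) + (-(1 / height y ^ 3) + k * (1 / height y)) * ‖y‖ ^ 2 +
          k * (-(1 / height y ^ 3)) * (‖y‖ ^ 2) ^ 2),
        n * P y + (q + k * P y) * ‖y‖ ^ 2 + k * q * (‖y‖ ^ 2) ^ 2) := by
  simp only [inducedMetric_graphMap hP.self_of_nhds, inv_one_sub_smul_vecMulVec y hD, ← hk,
    pd₂_graphMap hP hq, ← sum_one_add_vecMulVec_mul]
  simp only [Prod.ext_iff, Prod.fst_sum, Prod.snd_sum, Prod.smul_mk, smul_zero, smul_eq_mul,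
    Finset.sum_const_zero, and_self]

/-- A normal field of a rotationally symmetric graph. -/
noncomputable def radialNormal (p : ℝ) (y : E n) : Ambient n :=
  (((height y ^ 2 * p) • y, height y * p * ‖y‖ ^ 2), 1)

/-- Orthogonality to the graph makes the space part a multiple of y, and tangency to the hyperboloid
fixes the remaining component. The normal space is thus a line, whose generator is scaled to have
last component 1. -/
theorem isNormalVec_graphMap_iff {u : E n → ℝ} {p : ℝ} {y : E n} (h : HasRadialDerivAt u p y)
    (ν : Ambient n) : IsNormalVec (graphMap u) y ν ↔ ν = ν.2 • radialNormal p y := by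
  have ha := height_pos y
  have ha2 := height_sq y
  constructor
  · rintro ⟨h1, h2⟩
    obtain ⟨⟨ν₁, ν₂⟩, ν₃⟩ := ν
    simp only [graphMap, lor] at h1
    simp only [h.fderiv_graphMap, g, lor] at h2
    have h3 : ν₁ = (1 / height y * ν₂ + p * ν₃) • y := by
      refine ext_inner_left ℝ fun v => ?_
      have := h2 v
      rw [inner_smul_right, real_inner_comm y v]
      linarith
    have h4 : ν₂ = ν₃ * (height y * p * ‖y‖ ^ 2) := by
      rw [h3, inner_smul_right, real_inner_self_eq_norm_sq] at h1
      have hz : ‖y‖ ^ 2 = height y ^ 2 - 1 := by linarith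
      rw [hz] at h1 ⊢
      field_simp at h1
      linear_combination (-1) * h1
    simp only [radialNormal, Prod.smul_mk, smul_eq_mul, mul_one, ← h4, Prod.mk.injEq, and_true]
    rw [smul_smul, h3]
    congr 1
    rw [h4, ha2]
    field_simp
    ring
  · intro hν
    rw [hν]
    simp only [IsNormalVec, graphMap, lor, radialNormal, g, h.fderiv_graphMap, Prod.smul_mk,
      inner_smul_right, real_inner_self_eq_norm_sq, smul_eq_mul, real_inner_comm y]
    refine ⟨by ring, fun v => ?_⟩
    have hz : ‖y‖ ^ 2 = height y ^ 2 - 1 := by linarith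
    rw [hz]
    field_simp
    ring

theorem g_radialNormal_self (p : ℝ) (y : E n) : g (radialNormal p y) (radialNormal p y) =
    -(height y ^ 2 * (1 - (1 / height y ^ 2 + p ^ 2) * ‖y‖ ^ 2)) := by
  have ha := height_pos y
  have ha2 := height_sq y
  simp only [g, lor, radialNormal, inner_smul_left, inner_smul_right, real_inner_self_eq_norm_sq]
  simp
  have hz : ‖y‖ ^ 2 = height y ^ 2 - 1 := by linarith
  rw [hz]
  field_simp
  ring

theorem g_smul_left (c : ℝ) (v w : Ambient n) : g (c • v) w = c * g v w := by
  simp only [g, lor, Prod.smul_fst, Prod.smul_snd, real_inner_smul_left, smul_eq_mul]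
  ring

theorem g_smul_right (c : ℝ) (v w : Ambient n) : g v (c • w) = c * g v w := by
  simp only [g, lor, Prod.smul_fst, Prod.smul_snd, real_inner_smul_right, smul_eq_mul]
  ring

/-- The equation of rotationally symmetric translators in terms of `z = |y|²`, where `p = 2 du/dz`
and `q = 2 dp/dz`. -/
def RadialEquation (m z p q : ℝ) : Prop :=
  z * q + p * (1 + 2 * z) / (1 + z) + (m * (1 + z) * p - 1) * (1 / (1 + z) - z * p ^ 2) = 0

/-- On the normal line g is nondegenerate, so the vector equation is equivalent to its product with
`radialNormal`. -/
theorem translatorAt_graphMap_iff {u P : E n → ℝ} {q : ℝ} {y : E n}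
    (hP : ∀ᶠ x in 𝓝 y, HasRadialDerivAt u (P x) x) (hq : HasRadialDerivAt P q y)
    (hD : 0 < 1 - (1 / height y ^ 2 + P y ^ 2) * ‖y‖ ^ 2) :
    TranslatorAt (graphMap u) y ↔ RadialEquation ((n : ℝ) - 1) (‖y‖ ^ 2) (P y) q := by
  have hP0 := hP.self_of_nhds
  have ha := height_pos y
  have ha2 := height_sq y
  have hNN := g_radialNormal_self (P y) y
  have hneg : g (radialNormal (P y) y) (radialNormal (P y) y) ≠ 0 := by
    rw [hNN]; exact neg_ne_zero.2 (by positivity)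
  have hN : IsNormalVec (graphMap u) y (radialNormal (P y) y) :=
    (isNormalVec_graphMap_iff hP0 _).2 (by simp [radialNormal])
  set T := ∑ i, ∑ j, (inducedMetric (graphMap u) y)⁻¹ i j • pd₂ (graphMap u) i j y with hT
  have key : g T (radialNormal (P y) y) = g (dt n) (radialNormal (P y) y) ↔
      RadialEquation ((n : ℝ) - 1) (‖y‖ ^ 2) (P y) q := by
    rw [hT, trace_pd₂_graphMap hP hq hD.ne' rfl]
    simp only [g, lor, radialNormal, dt, RadialEquation]
    set D := 1 - (1 / height y ^ 2 + P y ^ 2) * ‖y‖ ^ 2 with hDdef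
    simp only [inner_zero_left, Prod.fst_zero, Prod.snd_zero]
    have hD' : 1 / (1 + ‖y‖ ^ 2) - ‖y‖ ^ 2 * P y ^ 2 = D := by
      rw [hDdef, ha2]; field_simp; ring
    rw [hD']
    have hκ : (1 / height y ^ 2 + P y ^ 2) / D * ‖y‖ ^ 2 * D = 1 - D := by
      rw [div_mul_eq_mul_div, div_mul_cancel₀ _ hD.ne', hDdef]; ring
    set k := (1 / height y ^ 2 + P y ^ 2) / D
    clear_value D k
    -- This identity eliminates the coefficient of the inverse metric; multiplication by D > 0 then
    -- clears the denominators.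
    have hk : k * ‖y‖ ^ 2 = 1 / D - 1 := by field_simp; linarith
    generalize ‖y‖ ^ 2 = z at *
    generalize height y = a at *
    generalize P y = p at *
    have hz : 1 + z = a ^ 2 := ha2.symm
    have hz' : z = a ^ 2 - 1 := by linarith
    have e1 : (0 - (n * (1 / a) + (-(1 / a ^ 3) + k * (1 / a)) * z + k * -(1 / a ^ 3) * z ^ 2) *
        (a * p * z) - (n * p + (q + k * p) * z + k * q * z ^ 2) * 1) =
        -(p * z * (n - z / a ^ 2 + k * z - k * z * z / a ^ 2) + n * p + q * z + k * z * p +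
          k * z * q * z) := by field_simp; ring
    have e2 : (p * z * (n - z / a ^ 2 + k * z - k * z * z / a ^ 2) + n * p + q * z + k * z * p +
          k * z * q * z - 1) * D = z * q + p * (1 + 2 * z) / (1 + z) +
            ((n - 1) * (1 + z) * p - 1) * D := by
      rw [hk, hz, hz']; field_simp; ring
    rw [e1, ← e2, mul_eq_zero, or_iff_left hD.ne']
    constructor <;> intro h <;> linarith
  rw [← key]
  constructor
  · rintro ⟨H, ⟨-, h1⟩, ⟨-, h2⟩⟩
    rw [← h1 _ hN, h2 _ hN]
  · intro h
    have hpart : ∀ v : Ambient n, IsNormalPart (graphMap u) y v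
        ((g v (radialNormal (P y) y) / g (radialNormal (P y) y) (radialNormal (P y) y)) •
          radialNormal (P y) y) := by
      intro v
      refine ⟨(isNormalVec_graphMap_iff hP0 _).2 (by simp [radialNormal]), fun ν hν => ?_⟩
      rw [(isNormalVec_graphMap_iff hP0 ν).1 hν, g_smul_left, g_smul_right, g_smul_right]
      field_simp
    refine ⟨_, hpart T, ?_⟩
    rw [h]
    exact hpart _

theorem spacelikeAt_graphMap {u : E n → ℝ} {p : ℝ} {y : E n} (h : HasRadialDerivAt u p y)
    (hD : 0 < 1 - (1 / height y ^ 2 + p ^ 2) * ‖y‖ ^ 2) : SpacelikeAt (graphMap u) y := by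
  intro v hv
  have hv2 : 0 < ‖v‖ ^ 2 := by have := norm_pos_iff.2 hv; positivity
  have hcs : inner ℝ y v ^ 2 ≤ ‖y‖ ^ 2 * ‖v‖ ^ 2 := by
    have := abs_real_inner_le_norm y v
    rw [← sq_abs, ← mul_pow]
    exact pow_le_pow_left₀ (abs_nonneg _) this 2
  have ha := height_pos y
  simp only [h.fderiv_graphMap, g, lor, real_inner_self_eq_norm_sq]
  have hc : 0 ≤ 1 / height y ^ 2 + p ^ 2 := by positivity
  have h1 := mul_le_mul_of_nonneg_left hcs hc
  have h2 := mul_pos hD hv2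
  have : (1 / height y ^ 2 + p ^ 2) * inner ℝ y v ^ 2 = 1 / height y * inner ℝ y v *
    (1 / height y * inner ℝ y v) + p * inner ℝ y v * (p * inner ℝ y v) := by field_simp
  linarith

/-- The radial direction v = y is an eigenvector of the induced metric with this eigenvalue. -/
theorem SpacelikeAt.discriminant_pos {u : E n → ℝ} {p : ℝ} {y : E n} (h : HasRadialDerivAt u p y)
    (hs : SpacelikeAt (graphMap u) y) : 0 < 1 - (1 / height y ^ 2 + p ^ 2) * ‖y‖ ^ 2 := by
  rcases eq_or_ne y 0 with rfl | hy
  · simp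
  have h1 := hs y hy
  simp only [h.fderiv_graphMap, g, lor, real_inner_self_eq_norm_sq] at h1
  have hv2 : 0 < ‖y‖ ^ 2 := by have := norm_pos_iff.2 hy; positivity
  have ha := height_pos y
  refine pos_of_mul_pos_left (b := ‖y‖ ^ 2) ?_ hv2.le
  linarith [show (1 - (1 / height y ^ 2 + p ^ 2) * ‖y‖ ^ 2) * ‖y‖ ^ 2 = ‖y‖ ^ 2 -
    1 / height y * ‖y‖ ^ 2 * (1 / height y * ‖y‖ ^ 2) - p * ‖y‖ ^ 2 * (p * ‖y‖ ^ 2) by ring]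

theorem mem_hyp_iff {p : L n} : p ∈ hyp n ↔ p.2 = height p.1 := by
  simp only [hyp, lor, mem_ofPred_eq, real_inner_self_eq_norm_sq]
  constructor
  · rintro ⟨h1, h2⟩
    rw [height, eq_comm, Real.sqrt_eq_iff_mul_self_eq (by positivity) h2.le]
    linarith
  · intro h
    have := height_sq p.1
    rw [h]
    exact ⟨by linarith, height_pos _⟩

theorem fst_graphMap_mem_hyp (u : E n → ℝ) (y : E n) : (graphMap u y).1 ∈ hyp n :=
  mem_hyp_iff.2 rfl

/-! ### Independence of the parametrization -/

/-- The flat metric as a bilinear map. -/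
noncomputable def metric (n : ℕ) : Ambient n →ₗ[ℝ] Ambient n →ₗ[ℝ] ℝ :=
  LinearMap.mk₂ ℝ g
    (fun v₁ v₂ w => by simp only [g, lor, Prod.fst_add, Prod.snd_add, inner_add_left]; ring)
    g_smul_left
    (fun v w₁ w₂ => by simp only [g, lor, Prod.fst_add, Prod.snd_add, inner_add_right]; ring)
    g_smul_right

@[simp] theorem metric_apply (v w : Ambient n) : metric n v w = g v w := rfl

theorem trace_inv_mul_transpose_congr {ι : Type*} [Fintype ι] [DecidableEq ι]
    {J G B : Matrix ι ι ℝ} (hJ : IsUnit J.det) :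
    ((J.transpose * G * J)⁻¹ * (J.transpose * B * J).transpose).trace =
      (G⁻¹ * B.transpose).trace := by
  have hJt : IsUnit J.transpose.det := by rwa [Matrix.det_transpose]
  rw [Matrix.mul_inv_rev, Matrix.mul_inv_rev, Matrix.transpose_mul, Matrix.transpose_mul,
    Matrix.transpose_transpose]
  have : J⁻¹ * (G⁻¹ * J.transpose⁻¹) * (J.transpose * (B.transpose * J)) =
      J⁻¹ * (G⁻¹ * B.transpose * J) := by
    rw [Matrix.mul_assoc, Matrix.mul_assoc, ← Matrix.mul_assoc J.transpose⁻¹,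
      Matrix.nonsing_inv_mul _ hJt, Matrix.one_mul, Matrix.mul_assoc]
  rw [this, Matrix.trace_mul_comm, Matrix.mul_assoc, Matrix.mul_nonsing_inv _ hJ, Matrix.mul_one]

theorem sum_mul_eq_trace {ι : Type*} [Fintype ι] (A B : Matrix ι ι ℝ) :
    ∑ i, ∑ j, A i j * B i j = (A * B.transpose).trace := by
  simp [Matrix.trace, Matrix.mul_apply]

/-- The trace of a bilinear form with respect to another one does not depend on the basis. -/
theorem trace_bilin_comp (b c : E n →ₗ[ℝ] E n →ₗ[ℝ] ℝ) (A : E n ≃L[ℝ] E n) :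
    ∑ i, ∑ j, (Matrix.of fun i j => b (A (basisVec i)) (A (basisVec j)))⁻¹ i j *
        c (A (basisVec i)) (A (basisVec j)) =
      ∑ i, ∑ j, (Matrix.of fun i j => b (basisVec i) (basisVec j))⁻¹ i j *
        c (basisVec i) (basisVec j) := by
  set e := (EuclideanSpace.basisFun (Fin n) ℝ).toBasis
  have he : ∀ i, e i = basisVec i := fun i => by simp [e, basisVec]
  set l : E n →ₗ[ℝ] E n := (A.toLinearEquiv : E n →ₗ[ℝ] E n)
  set J := LinearMap.toMatrix e e l
  have hJ : IsUnit J.det := A.toLinearEquiv.isUnit_det e e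
  have hM : ∀ b : E n →ₗ[ℝ] E n →ₗ[ℝ] ℝ,
      (Matrix.of fun i j => b (A (basisVec i)) (A (basisVec j))) =
        J.transpose * (Matrix.of fun i j => b (basisVec i) (basisVec j)) * J := by
    intro b
    have h := LinearMap.toMatrix₂_compl₁₂ e e e e b l l
    have h1 : (Matrix.of fun i j => b (basisVec i) (basisVec j)) = LinearMap.toMatrix₂ e e b := by
      ext i j; simp [LinearMap.toMatrix₂_apply, he]
    rw [h1, ← h]
    ext i j
    simp [LinearMap.toMatrix₂_apply, he, l]
  have h := trace_inv_mul_transpose_congr (G := Matrix.of fun i j => b (basisVec i) (basisVec j))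
    (B := Matrix.of fun i j => c (basisVec i) (basisVec j)) hJ
  rw [← hM b, ← hM c, ← sum_mul_eq_trace, ← sum_mul_eq_trace] at h
  exact h

theorem pd₂_eq {Y : E n → Ambient n} {y : E n} (hY : ContDiffAt ℝ 2 Y y) (i j : Fin n) :
    pd₂ Y i j y = fderiv ℝ (fderiv ℝ Y) y (basisVec i) (basisVec j) := by
  have h1 : DifferentiableAt ℝ (fderiv ℝ Y) y :=
    (hY.fderiv_right (m := 1) (by norm_num)).differentiableAt one_ne_zero
  have h2 := h1.hasFDerivAt.clm_apply (hasFDerivAt_const (basisVec j : E n) y)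
  change fderiv ℝ (fun x => fderiv ℝ Y x (basisVec j)) y (basisVec i) = _
  rw [h2.fderiv]
  simp

section Reparametrization

variable {X Y : E n → Ambient n} {φ : E n → E n} {x : E n} {A : E n ≃L[ℝ] E n}

theorem fderiv_comp_eventuallyEq (hXY : X =ᶠ[𝓝 x] Y ∘ φ) (hφ : ContDiffAt ℝ 2 φ x)
    (hY : ContDiffAt ℝ 2 Y (φ x)) :
    ∀ᶠ x' in 𝓝 x, fderiv ℝ X x' = (fderiv ℝ Y (φ x')).comp (fderiv ℝ φ x') := by
  have h1 : ∀ᶠ x' in 𝓝 x, ContDiffAt ℝ 2 φ x' := hφ.eventually (by simp)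
  have h2 : ∀ᶠ x' in 𝓝 x, ContDiffAt ℝ 2 Y (φ x') :=
    hφ.continuousAt.eventually (hY.eventually (by simp))
  filter_upwards [hXY.eventuallyEq_nhds, h1, h2] with x' h h1 h2
  rw [h.fderiv_eq]
  exact fderiv_comp x' (h2.differentiableAt two_ne_zero) (h1.differentiableAt two_ne_zero)

/-- The term with the second derivative of φ lies in the image of dY. It is tangent and disappears
in products with normal vectors. -/
theorem pd₂_comp (hXY : X =ᶠ[𝓝 x] Y ∘ φ) (hφ : ContDiffAt ℝ 2 φ x)
    (hY : ContDiffAt ℝ 2 Y (φ x)) (i j : Fin n) :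
    pd₂ X i j x = fderiv ℝ (fderiv ℝ Y) (φ x) (fderiv ℝ φ x (basisVec i))
      (fderiv ℝ φ x (basisVec j)) +
        fderiv ℝ Y (φ x) (fderiv ℝ (fderiv ℝ φ) x (basisVec i) (basisVec j)) := by
  have hev : pd X j =ᶠ[𝓝 x] fun x' => fderiv ℝ Y (φ x') (fderiv ℝ φ x' (basisVec j)) := by
    filter_upwards [fderiv_comp_eventuallyEq hXY hφ hY] with x' h
    rw [pd, h]; rfl
  have h1 : DifferentiableAt ℝ (fderiv ℝ Y) (φ x) :=
    (hY.fderiv_right (m := 1) (by norm_num)).differentiableAt one_ne_zero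
  have h2 : DifferentiableAt ℝ (fderiv ℝ φ) x :=
    (hφ.fderiv_right (m := 1) (by norm_num)).differentiableAt one_ne_zero
  have h3 := h1.hasFDerivAt.comp x (hφ.differentiableAt two_ne_zero).hasFDerivAt
  have h4 := h2.hasFDerivAt.clm_apply (hasFDerivAt_const (basisVec j : E n) x)
  have h5 := h3.clm_apply h4
  rw [pd₂, hev.fderiv_eq]
  refine (congrArg (fun F => F (basisVec i)) h5.fderiv).trans ?_
  simp [add_comm]

theorem isNormalPart_comp_iff (hXY : X =ᶠ[𝓝 x] Y ∘ φ) (hφ : ContDiffAt ℝ 2 φ x)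
    (hY : ContDiffAt ℝ 2 Y (φ x)) (hA : fderiv ℝ φ x = A) (v h : Ambient n) :
    IsNormalPart X x v h ↔ IsNormalPart Y (φ x) v h := by
  have hn : ∀ ν, IsNormalVec X x ν ↔ IsNormalVec Y (φ x) ν := by
    intro ν
    rw [IsNormalVec, IsNormalVec, (fderiv_comp_eventuallyEq hXY hφ hY).self_of_nhds,
      hXY.self_of_nhds, hA]
    refine and_congr Iff.rfl ⟨fun h v => ?_, fun h v => h _⟩
    have := h (A.symm v)
    simpa using this
  simp only [IsNormalPart, hn]

/-- The translator equation does not depend on the parametrization. -/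
theorem TranslatorAt.of_comp (hXY : X =ᶠ[𝓝 x] Y ∘ φ) (hφ : ContDiffAt ℝ 2 φ x)
    (hY : ContDiffAt ℝ 2 Y (φ x)) (hA : fderiv ℝ φ x = A) (h : TranslatorAt X x) :
    TranslatorAt Y (φ x) := by
  obtain ⟨H, h1, h2⟩ := h
  rw [IsMeanCurvatureVec, isNormalPart_comp_iff hXY hφ hY hA] at h1
  rw [isNormalPart_comp_iff hXY hφ hY hA] at h2
  refine ⟨H, ⟨h1.1, fun ν hν => ?_⟩, h2⟩
  rw [h1.2 ν hν]
  have hsum : ∀ (M : Matrix (Fin n) (Fin n) ℝ) (V : Fin n → Fin n → Ambient n),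
      g (∑ i, ∑ j, M i j • V i j) ν = ∑ i, ∑ j, M i j * g (V i j) ν := by
    intro M V
    rw [← metric_apply]
    simp only [map_sum, LinearMap.sum_apply, map_smul, LinearMap.smul_apply, metric_apply,
      smul_eq_mul]
  rw [hsum, hsum]
  set b : E n →ₗ[ℝ] E n →ₗ[ℝ] ℝ :=
    (metric n).compl₁₂ (fderiv ℝ Y (φ x)).toLinearMap (fderiv ℝ Y (φ x)).toLinearMap
  set c : E n →ₗ[ℝ] E n →ₗ[ℝ] ℝ := LinearMap.mk₂ ℝ
    (fun v w => (metric n).flip ν (fderiv ℝ (fderiv ℝ Y) (φ x) v w))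
    (by intros; simp) (by intros; simp) (by intros; simp) (by intros; simp)
  have hG : inducedMetric X x = Matrix.of fun i j => b (A (basisVec i)) (A (basisVec j)) := by
    ext i j
    simp only [inducedMetric, pd, Matrix.of_apply,
      (fderiv_comp_eventuallyEq hXY hφ hY).self_of_nhds, hA]
    rfl
  have hB : ∀ i j, g (pd₂ X i j x) ν = c (A (basisVec i)) (A (basisVec j)) := by
    intro i j
    rw [pd₂_comp hXY hφ hY, hA, ← metric_apply, map_add, LinearMap.add_apply]
    simp only [metric_apply, hν.2, add_zero]
    rfl
  have hB' : ∀ i j, g (pd₂ Y i j (φ x)) ν = c (basisVec i) (basisVec j) := by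
    intro i j
    rw [pd₂_eq hY]
    rfl
  simp only [hB, hB', hG]
  exact trace_bilin_comp b c A

theorem SpacelikeAt.of_comp (hXY : X =ᶠ[𝓝 x] Y ∘ φ) (hφ : ContDiffAt ℝ 2 φ x)
    (hY : ContDiffAt ℝ 2 Y (φ x)) (hA : fderiv ℝ φ x = A) (h : SpacelikeAt X x) :
    SpacelikeAt Y (φ x) := by
  intro v hv
  have := h (A.symm v) (by simpa using hv)
  rw [(fderiv_comp_eventuallyEq hXY hφ hY).self_of_nhds, hA] at this
  simpa using this

end Reparametrization

/-! ### Space-like hypersurfaces as local graphs -/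

/-- The projection of a space-like hypersurface to the space coordinates is an immersion. -/
theorem SpacelikeAt.injective_fst {X : E n → Ambient n} {x : E n}
    (hX : ∀ᶠ x' in 𝓝 x, X x' ∈ space n) (hd : DifferentiableAt ℝ X x) (h : SpacelikeAt X x) :
    Function.Injective (fun v => (fderiv ℝ X x v).1.1) := by
  have hd1 : HasFDerivAt (fun x => (X x).1.2)
      (((ContinuousLinearMap.snd ℝ (E n) ℝ).comp (ContinuousLinearMap.fst ℝ (L n) ℝ)).comp
        (fderiv ℝ X x)) x :=
    ((ContinuousLinearMap.snd ℝ (E n) ℝ).comp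
      (ContinuousLinearMap.fst ℝ (L n) ℝ)).hasFDerivAt.comp x hd.hasFDerivAt
  have hd2 : HasFDerivAt (fun x => (X x).1.1)
      (((ContinuousLinearMap.fst ℝ (E n) ℝ).comp (ContinuousLinearMap.fst ℝ (L n) ℝ)).comp
        (fderiv ℝ X x)) x :=
    ((ContinuousLinearMap.fst ℝ (E n) ℝ).comp
      (ContinuousLinearMap.fst ℝ (L n) ℝ)).hasFDerivAt.comp x hd.hasFDerivAt
  have hr : HasFDerivAt height ((1 / height (X x).1.1) • innerSL ℝ (X x).1.1)
      ((fun x => (X x).1.1) x) := hasRadialDerivAt_height _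
  have hd3 := hr.comp x hd2
  have hev : (fun x => (X x).1.2) =ᶠ[𝓝 x] height ∘ fun x => (X x).1.1 :=
    hX.mono fun x' h => mem_hyp_iff.1 h
  have heq := hd1.unique (hd3.congr_of_eventuallyEq hev)
  -- If the space component of dX v vanishes, the hyperboloid constraint kills its xₙ₊₁ component
  -- too. What remains is vertical, hence not space-like unless v = 0.
  have hz : ∀ v, (fderiv ℝ X x v).1.1 = 0 → v = 0 := by
    intro v hv
    have h1 : (fderiv ℝ X x v).1.2 = _ := DFunLike.congr_fun heq v
    simp only [ContinuousLinearMap.comp_apply,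
      ContinuousLinearMap.coe_fst', hv, map_zero] at h1
    by_contra hne
    have := h v hne
    simp only [g, lor, hv, h1, inner_zero_left] at this
    nlinarith
  intro v w hvw
  refine sub_eq_zero.1 (hz _ ?_)
  rw [map_sub]
  simpa [sub_eq_zero] using hvw

/-- Near each of its points, a space-like translator is the graph of a function. -/
theorem IsSpacelikeTranslator.exists_local_graph {S : Set (Ambient n)}
    (hS : IsSpacelikeTranslator 2 S) {q : Ambient n} (hq : q ∈ S) :
    ∃ (u : E n → ℝ) (W : Set (E n)) (V : Set (Ambient n)), IsOpen W ∧ q.1.1 ∈ W ∧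
      IsOpen V ∧ q ∈ V ∧ ContDiffOn ℝ 2 u W ∧
      (∀ y ∈ W, graphMap u y ∈ S ∧ SpacelikeAt (graphMap u) y ∧ TranslatorAt (graphMap u) y) ∧
      ∀ p ∈ V, p.1.1 ∈ W ∧ (p ∈ S ↔ p.1 ∈ hyp n ∧ p.2 = u p.1.1) := by
  obtain ⟨hSsub, hS⟩ := hS
  obtain ⟨U, X, hX, ⟨x₀, hx₀, rfl⟩, hXU⟩ := hS q hq
  have hUS : ∀ x ∈ U, X x ∈ S := by
    obtain ⟨V, -, hV⟩ := hX.image_eq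
    exact fun x hx => (hV.subset (mem_image_of_mem X hx)).1
  have hXc : ∀ x ∈ U, ContDiffAt ℝ 2 X x := fun x hx =>
    hX.contDiffOn.contDiffAt (hX.isOpen.mem_nhds hx)
  set φ : E n → E n := fun x => (X x).1.1
  have hφ : ∀ x ∈ U, ContDiffAt ℝ 2 φ x := fun x hx => (hXc x hx).fst.fst
  have hdφ : ∀ x ∈ U, ∃ A : E n ≃L[ℝ] E n, fderiv ℝ φ x = A := by
    intro x hx
    have hinj := (hXU x hx).1.injective_fst
      (Filter.mem_of_superset (hX.isOpen.mem_nhds hx) fun x' hx' => hSsub (hUS x' hx'))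
      ((hXc x hx).differentiableAt two_ne_zero)
    have hd2 : HasFDerivAt φ
        (((ContinuousLinearMap.fst ℝ (E n) ℝ).comp (ContinuousLinearMap.fst ℝ (L n) ℝ)).comp
          (fderiv ℝ X x)) x :=
      ((ContinuousLinearMap.fst ℝ (E n) ℝ).comp
        (ContinuousLinearMap.fst ℝ (L n) ℝ)).hasFDerivAt.comp x
          ((hXc x hx).differentiableAt two_ne_zero).hasFDerivAt
    refine ⟨(LinearEquiv.ofInjectiveEndo (fderiv ℝ φ x).toLinearMap ?_).toContinuousLinearEquiv, ?_⟩
    · rw [hd2.fderiv]; exact hinj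
    · ext1 v; simp
  obtain ⟨A₀, hA₀⟩ := hdφ x₀ hx₀
  have hA₀' : HasFDerivAt φ (A₀ : E n →L[ℝ] E n) x₀ := by
    rw [← hA₀]; exact ((hφ x₀ hx₀).differentiableAt two_ne_zero).hasFDerivAt
  set e := (hφ x₀ hx₀).toOpenPartialHomeomorph φ hA₀' two_ne_zero with he
  have hecoe : ∀ x, e x = φ x := fun x => rfl
  have hx₀e : x₀ ∈ e.source := (hφ x₀ hx₀).mem_toOpenPartialHomeomorph_source hA₀' two_ne_zero
  have hsymm : ContDiffAt ℝ 2 e.symm (φ x₀) := (hφ x₀ hx₀).to_localInverse hA₀' two_ne_zero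
  obtain ⟨N, hN, hNo, hx₀N⟩ := eventually_nhds_iff.1 (hsymm.eventually (by simp))
  set W := (e.target ∩ e.symm ⁻¹' U) ∩ N
  have hW : IsOpen W := (e.symm.isOpen_inter_preimage hX.isOpen).inter hNo
  have hx₀W : φ x₀ ∈ W := by
    refine ⟨⟨e.map_source hx₀e, ?_⟩, hx₀N⟩
    have : e.symm (φ x₀) = x₀ := e.left_inv hx₀e
    rw [mem_preimage, this]
    exact hx₀
  set U' := e.source ∩ e ⁻¹' W
  have hU' : IsOpen U' := e.isOpen_inter_preimage hW
  have hU'U : U' ⊆ U := fun x hx => by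
    have h1 : e.symm (e x) ∈ U := hx.2.1.2
    rwa [e.left_inv hx.1] at h1
  have hWU' : ∀ y ∈ W, e.symm y ∈ U' := fun y hy =>
    ⟨e.map_target hy.1.1, by rw [mem_preimage, e.right_inv hy.1.1]; exact hy⟩
  set u : E n → ℝ := fun y => (X (e.symm y)).2
  have hgraph : ∀ y ∈ W, graphMap u y = X (e.symm y) := by
    intro y hy
    have h1 : (X (e.symm y)).1.1 = y := e.right_inv hy.1.1
    have h2 := mem_hyp_iff.1 (hSsub (hUS _ hy.1.2))
    rw [h1] at h2
    rw [graphMap, ← h2]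
    exact Prod.ext (Prod.ext h1.symm rfl) rfl
  have hu : ContDiffOn ℝ 2 u W := fun y hy =>
    (((hXc _ hy.1.2).comp y (hN y hy.2)).snd).contDiffWithinAt
  have hgu : ∀ y ∈ W, ContDiffAt ℝ 2 (graphMap u) y := by
    intro y hy
    exact (contDiffAt_id.prodMk contDiff_height.contDiffAt).prodMk
      (hu.contDiffAt (hW.mem_nhds hy))
  obtain ⟨V₀, hV₀, hV₀'⟩ := hX.image_eq
  -- Since X is an embedding, the smaller parameter domain is cut out by an ambient open set. This
  -- keeps other pieces of S out of the neighbourhood.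
  obtain ⟨V₁, hV₁, hV₁'⟩ : ∃ V₁ : Set (Ambient n), IsOpen V₁ ∧ ∀ x ∈ U, (x ∈ U' ↔ X x ∈ V₁) := by
    obtain ⟨V₁, hV₁, h⟩ := hX.isEmbedding.isInducing.isOpen_iff.1
      (hU'.preimage (continuous_subtype_val (p := fun x => x ∈ U)))
    refine ⟨V₁, hV₁, fun x hx => ?_⟩
    have := Set.ext_iff.1 h ⟨x, hx⟩
    exact this.symm
  refine ⟨u, W, (V₀ ∩ V₁) ∩ (fun p => p.1.1) ⁻¹' W, hW, hx₀W, (hV₀.inter hV₁).inter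
    (hW.preimage (by fun_prop)), ⟨⟨(hV₀'.subset (mem_image_of_mem X hx₀)).2,
      (hV₁' x₀ hx₀).1 ⟨hx₀e, hx₀W⟩⟩, hx₀W⟩, hu, ?_, ?_⟩
  · intro y hy
    have hyU' := hWU' y hy
    have hyU := hU'U hyU'
    have hφy : φ (e.symm y) = y := e.right_inv hy.1.1
    have hXY : X =ᶠ[𝓝 (e.symm y)] graphMap u ∘ φ := by
      filter_upwards [hU'.mem_nhds hyU'] with x hx
      have h1 : e.symm (φ x) = x := e.left_inv hx.1
      rw [Function.comp_apply, hgraph (φ x) hx.2, h1]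
    obtain ⟨A, hA⟩ := hdφ _ hyU
    refine ⟨by rw [hgraph y hy]; exact hUS _ hyU, ?_, ?_⟩
    · have := (hXU _ hyU).1.of_comp hXY (hφ _ hyU) (by rw [hφy]; exact hgu y hy) hA
      rwa [hφy] at this
    · have := (hXU _ hyU).2.of_comp hXY (hφ _ hyU) (by rw [hφy]; exact hgu y hy) hA
      rwa [hφy] at this
  · rintro p ⟨⟨hp₀, hp₁⟩, hpW⟩
    refine ⟨hpW, fun hpS => ?_, fun hp => ?_⟩
    · obtain ⟨x, hxU, rfl⟩ := hV₀'.superset ⟨hpS, hp₀⟩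
      have hx := (hV₁' x hxU).2 hp₁
      have h1 : e.symm (φ x) = x := e.left_inv hx.1
      refine ⟨hSsub hpS, ?_⟩
      change _ = (X (e.symm (φ x))).2
      rw [h1]
    · have : p = graphMap u p.1.1 :=
        Prod.ext (Prod.ext rfl (mem_hyp_iff.1 hp.1)) hp.2
      rw [this, hgraph _ hpW]
      exact hUS _ hpW.1.2

/-! ### The translator equation in the hyperbolic distance -/

theorem tau_eq {p : L n} (hp : p ∈ hyp n) : tau p = Real.arsinh ‖p.1‖ := by
  rw [tau, mem_hyp_iff.1 hp, Real.arsinh, height_sq, height, add_sub_cancel_left,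
    Real.sqrt_sq (norm_nonneg _)]

theorem mem_radialGraph_iff {f : ℝ → ℝ} {J : Set ℝ} {q : Ambient n} :
    q ∈ radialGraph n f J ↔
      q.1 ∈ hyp n ∧ Real.arsinh ‖q.1.1‖ ∈ J ∧ q.2 = f (Real.arsinh ‖q.1.1‖) := by
  refine and_congr_right fun h => ?_
  rw [tau_eq h]

theorem height_eq_cosh (y : E n) : height y = Real.cosh (Real.arsinh ‖y‖) := by
  rw [Real.cosh_arsinh, height]

theorem arsinh_norm_nonneg (y : E n) : 0 ≤ Real.arsinh ‖y‖ := Real.arsinh_nonneg_iff.2 (norm_nonneg y)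

/-- With s = arsinh |y| one has |y| = sinh s and height cosh s, so ds = ⟨y, ·⟩ / (height · |y|). -/
theorem hasRadialDerivAt_comp_arsinh {f : ℝ → ℝ} {f' : ℝ} {y : E n} (hy : y ≠ 0)
    (hf : HasDerivAt f f' (Real.arsinh ‖y‖)) :
    HasRadialDerivAt (fun y => f (Real.arsinh ‖y‖)) (f' / (height y * ‖y‖)) y := by
  have hy0 : 0 < ‖y‖ := norm_pos_iff.2 hy
  have hsq : √(‖y‖ ^ 2) = ‖y‖ := Real.sqrt_sq hy0.le
  have h1 : HasDerivAt (fun z => √z) (1 / (2 * ‖y‖)) (‖y‖ ^ 2) := by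
    have := (hasDerivAt_id' (‖y‖ ^ 2)).sqrt (by positivity)
    rwa [hsq] at this
  have h2 : HasDerivAt Real.arsinh (√(1 + ‖y‖ ^ 2))⁻¹ (√(‖y‖ ^ 2)) := by
    rw [hsq]; exact Real.hasDerivAt_arsinh _
  have h3 : HasDerivAt f f' (Real.arsinh (√(‖y‖ ^ 2))) := by rwa [hsq]
  have h4 := hasRadialDerivAt_comp_norm_sq (h3.comp (‖y‖ ^ 2) (h2.comp (‖y‖ ^ 2) h1))
  have hfun : (fun y : E n => (f ∘ Real.arsinh ∘ fun z => √z) (‖y‖ ^ 2)) =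
      fun y => f (Real.arsinh ‖y‖) := by
    ext x; simp [Real.sqrt_sq (norm_nonneg x)]
  have hval : 2 * (f' * ((√(1 + ‖y‖ ^ 2))⁻¹ * (1 / (2 * ‖y‖)))) = f' / (height y * ‖y‖) := by
    have := height_pos y
    rw [height] at *
    field_simp
  rwa [hfun, hval] at h4

theorem HasRadialDerivAt.congr_of_eventuallyEq {u v : E n → ℝ} {p : ℝ} {y : E n}
    (h : HasRadialDerivAt u p y) (hvu : v =ᶠ[𝓝 y] u) : HasRadialDerivAt v p y :=
  HasFDerivAt.congr_of_eventuallyEq h hvu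

theorem eventually_hasRadialDerivAt {f w : ℝ → ℝ} {u : E n → ℝ} {y : E n} (hy : y ≠ 0)
    (hf : ∀ᶠ t in 𝓝 (Real.arsinh ‖y‖), HasDerivAt f (w t) t)
    (hu : u =ᶠ[𝓝 y] fun y => f (Real.arsinh ‖y‖)) :
    ∀ᶠ x in 𝓝 y, HasRadialDerivAt u (w (Real.arsinh ‖x‖) / (height x * ‖x‖)) x := by
  have hc : Tendsto (fun x : E n => Real.arsinh ‖x‖) (𝓝 y) (𝓝 (Real.arsinh ‖y‖)) :=
    (Real.continuous_arsinh.comp continuous_norm).tendsto y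
  filter_upwards [hu.eventuallyEq_nhds, hc.eventually hf, isOpen_ne.mem_nhds hy] with x h1 h2 h3
  exact (hasRadialDerivAt_comp_arsinh h3 h2).congr_of_eventuallyEq h1

theorem discriminant_eq {y : E n} (hy : y ≠ 0) (w : ℝ) :
    1 - (1 / height y ^ 2 + (w / (height y * ‖y‖)) ^ 2) * ‖y‖ ^ 2 = (1 - w ^ 2) / height y ^ 2 := by
  have hy0 : 0 < ‖y‖ := norm_pos_iff.2 hy
  have ha := height_pos y
  have := height_sq y
  field_simp
  linarith

/-- The last argument is the radial derivative of w / (cosh s sinh s). After substitution the radial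
equation is the profile equation divided by the squared height. -/
theorem radialEquation_iff {y : E n} (hy : y ≠ 0) (m w w' : ℝ) :
    RadialEquation m (‖y‖ ^ 2) (w / (height y * ‖y‖))
      ((w' * (height y * ‖y‖) - w * (‖y‖ * ‖y‖ + height y * height y)) / (height y * ‖y‖) ^ 2 /
        (height y * ‖y‖)) ↔ w' = slopeField m (Real.arsinh ‖y‖) w := by
  have hy0 : 0 < ‖y‖ := norm_pos_iff.2 hy
  have ha := height_pos y
  have ha2 := height_sq y
  rw [RadialEquation, slopeField, ← height_eq_cosh, Real.sinh_arsinh]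
  generalize height y = a at *
  generalize ‖y‖ = r at *
  have hr : r ^ 2 = a ^ 2 - 1 := by linarith
  rw [← ha2]
  have key : r ^ 2 * ((w' * (a * r) - w * (r * r + a * a)) / (a * r) ^ 2 / (a * r)) +
      w / (a * r) * (1 + 2 * r ^ 2) / a ^ 2 +
      (m * a ^ 2 * (w / (a * r)) - 1) * (1 / a ^ 2 - r ^ 2 * (w / (a * r)) ^ 2) =
      (w' - (1 - w ^ 2) * (1 - m * (a / r) * w)) / a ^ 2 := by
    field_simp
    rw [ha2]
    ring
  rw [key, div_eq_zero_iff, or_iff_left (by positivity), sub_eq_zero]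

theorem hasRadialDerivAt_div_height {w : ℝ → ℝ} {w' : ℝ} {y : E n} (hy : y ≠ 0)
    (hw : HasDerivAt w w' (Real.arsinh ‖y‖)) :
    HasRadialDerivAt (fun x => w (Real.arsinh ‖x‖) / (height x * ‖x‖))
      ((w' * (height y * ‖y‖) - w (Real.arsinh ‖y‖) * (‖y‖ * ‖y‖ + height y * height y)) /
        (height y * ‖y‖) ^ 2 / (height y * ‖y‖)) y := by
  have hy0 : 0 < ‖y‖ := norm_pos_iff.2 hy
  have ha := height_pos y
  have hsinh : Real.sinh (Real.arsinh ‖y‖) = ‖y‖ := Real.sinh_arsinh _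
  have hd : HasDerivAt (fun s => w s / (Real.cosh s * Real.sinh s))
      ((w' * (height y * ‖y‖) - w (Real.arsinh ‖y‖) * (‖y‖ * ‖y‖ + height y * height y)) /
        (height y * ‖y‖) ^ 2) (Real.arsinh ‖y‖) := by
    have h := hw.div ((Real.hasDerivAt_cosh _).mul (Real.hasDerivAt_sinh (Real.arsinh ‖y‖)))
      (by rw [Pi.mul_apply, ← height_eq_cosh, hsinh]; positivity)
    refine h.congr_deriv ?_
    simp only [Pi.mul_apply, ← height_eq_cosh, hsinh]
  have hq := hasRadialDerivAt_comp_arsinh hy hd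
  simpa only [← height_eq_cosh, Real.sinh_arsinh] using hq

theorem translatorAt_radial_iff {f w : ℝ → ℝ} {w' : ℝ} {u : E n → ℝ} {y : E n} (hy : y ≠ 0)
    (hf : ∀ᶠ t in 𝓝 (Real.arsinh ‖y‖), HasDerivAt f (w t) t)
    (hw : HasDerivAt w w' (Real.arsinh ‖y‖)) (h1 : |w (Real.arsinh ‖y‖)| < 1)
    (hu : u =ᶠ[𝓝 y] fun y => f (Real.arsinh ‖y‖)) :
    TranslatorAt (graphMap u) y ↔
      w' = slopeField ((n : ℝ) - 1) (Real.arsinh ‖y‖) (w (Real.arsinh ‖y‖)) := by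
  have hy0 : 0 < ‖y‖ := norm_pos_iff.2 hy
  have ha := height_pos y
  have hP := eventually_hasRadialDerivAt hy hf hu
  have hq := hasRadialDerivAt_div_height hy hw
  rw [translatorAt_graphMap_iff hP hq ?_, radialEquation_iff hy]
  rw [discriminant_eq hy]
  have := (sq_lt_one_iff_abs_lt_one _).2 h1
  have := sub_pos.2 this
  positivity

theorem spacelikeAt_radial_iff {f w : ℝ → ℝ} {u : E n → ℝ} {y : E n} (hy : y ≠ 0)
    (hf : ∀ᶠ t in 𝓝 (Real.arsinh ‖y‖), HasDerivAt f (w t) t)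
    (hu : u =ᶠ[𝓝 y] fun y => f (Real.arsinh ‖y‖)) :
    SpacelikeAt (graphMap u) y ↔ |w (Real.arsinh ‖y‖)| < 1 := by
  have hP := (eventually_hasRadialDerivAt hy hf hu).self_of_nhds
  have ha := height_pos y
  have hiff : 0 < 1 - (1 / height y ^ 2 + (w (Real.arsinh ‖y‖) / (height y * ‖y‖)) ^ 2) * ‖y‖ ^ 2 ↔
      |w (Real.arsinh ‖y‖)| < 1 := by
    rw [discriminant_eq hy, div_pos_iff_of_pos_right (by positivity), sub_pos,
      sq_lt_one_iff_abs_lt_one]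
  rw [← hiff]
  exact ⟨fun h => h.discriminant_pos hP, spacelikeAt_graphMap hP⟩

/-! ### Rotational symmetry and local profiles -/

theorem exists_unit_smul_eq (hn : 1 ≤ n) (y : E n) : ∃ e : E n, ‖e‖ = 1 ∧ y = ‖y‖ • e := by
  rcases eq_or_ne y 0 with rfl | hy
  · exact ⟨basisVec ⟨0, hn⟩, by simp [basisVec], by simp⟩
  · have := norm_ne_zero_iff.2 hy
    refine ⟨‖y‖⁻¹ • y, ?_, ?_⟩
    · rw [norm_smul, norm_inv, norm_norm, inv_mul_cancel₀ this]
    · rw [smul_smul, mul_inv_cancel₀ this, one_smul]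

/-- For `n ≥ 2` the group `SO(n)` acts transitively on spheres. -/
theorem exists_rotation (hn : 2 ≤ n) {x y : E n} (h : ‖x‖ = ‖y‖) :
    ∃ A : E n ≃ₗᵢ[ℝ] E n, LinearMap.det (A.toLinearEquiv : E n →ₗ[ℝ] E n) = 1 ∧ A x = y := by
  rcases eq_or_ne x y with rfl | hne
  · exact ⟨LinearIsometryEquiv.refl ℝ _, LinearMap.det_id, rfl⟩
  obtain ⟨z, hz, hz0⟩ : ∃ z ∈ (ℝ ∙ y)ᗮ, z ≠ 0 := by
    refine Submodule.exists_mem_ne_zero_of_ne_bot fun hbot => ?_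
    have h1 := Submodule.finrank_add_finrank_orthogonal (ℝ ∙ y)
    rw [hbot, finrank_bot, finrank_euclideanSpace_fin] at h1
    have h2 := finrank_span_le_card (R := ℝ) ({y} : Set (E n))
    rw [Set.toFinset_singleton, Finset.card_singleton] at h2
    omega
  have hdet : ∀ v : E n, v ≠ 0 →
      LinearMap.det ((ℝ ∙ v)ᗮ.reflection.toLinearEquiv : E n →ₗ[ℝ] E n) = -1 := by
    intro v hv
    have := Submodule.det_reflection (𝕜 := ℝ) (ℝ ∙ v)ᗮ
    rw [Submodule.orthogonal_orthogonal, finrank_span_singleton hv, pow_one] at this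
    exact this
  -- The first reflection sends x to y but reverses orientation. The second fixes y, because z is
  -- orthogonal to y, and restores determinant 1.
  refine ⟨(ℝ ∙ (x - y))ᗮ.reflection.trans (ℝ ∙ z)ᗮ.reflection, ?_, ?_⟩
  · have h1 := LinearMap.det_comp ((ℝ ∙ z)ᗮ.reflection.toLinearEquiv : E n →ₗ[ℝ] E n)
      ((ℝ ∙ (x - y))ᗮ.reflection.toLinearEquiv : E n →ₗ[ℝ] E n)
    rw [hdet z hz0, hdet _ (sub_ne_zero.2 hne)] at h1
    rw [neg_mul_neg, one_mul] at h1
    exact h1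
  · rw [LinearIsometryEquiv.trans_apply, Submodule.reflection_sub h]
    refine Submodule.reflection_mem_subspace_eq_self ?_
    rw [Submodule.mem_orthogonal_singleton_iff_inner_right] at hz ⊢
    rwa [real_inner_comm]

/-- The point of the graph of `f ∘ τ` in direction `e` at distance `s` from the axis. -/
noncomputable def meridian (f : ℝ → ℝ) (e : E n) (s : ℝ) : Ambient n :=
  ((Real.sinh s • e, Real.cosh s), f s)

theorem norm_sinh_smul {e : E n} (he : ‖e‖ = 1) {s : ℝ} (hs : 0 ≤ s) :
    ‖Real.sinh s • e‖ = Real.sinh s := by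
  rw [norm_smul, he, mul_one, Real.norm_of_nonneg (Real.sinh_nonneg_iff.2 hs)]

theorem arsinh_norm_sinh_smul {e : E n} (he : ‖e‖ = 1) {s : ℝ} (hs : 0 ≤ s) :
    Real.arsinh ‖Real.sinh s • e‖ = s := by
  rw [norm_sinh_smul he hs, Real.arsinh_sinh]

theorem meridian_mem_radialGraph_iff {f h : ℝ → ℝ} {e : E n} (he : ‖e‖ = 1) {J : Set ℝ} {s : ℝ}
    (hs : 0 ≤ s) : meridian h e s ∈ radialGraph n f J ↔ s ∈ J ∧ h s = f s := by
  rw [mem_radialGraph_iff, mem_hyp_iff]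
  simp only [meridian]
  rw [height_eq_cosh, arsinh_norm_sinh_smul he hs]
  simp

theorem exists_eq_meridian (hn : 1 ≤ n) {f : ℝ → ℝ} {J : Set ℝ} {q : Ambient n}
    (hq : q ∈ radialGraph n f J) :
    ∃ e : E n, ‖e‖ = 1 ∧ q = meridian f e (Real.arsinh ‖q.1.1‖) := by
  rw [mem_radialGraph_iff, mem_hyp_iff] at hq
  obtain ⟨e, he, hye⟩ := exists_unit_smul_eq hn q.1.1
  refine ⟨e, he, Prod.ext (Prod.ext ?_ ?_) hq.2.2⟩
  · simp only [meridian]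
    rw [Real.sinh_arsinh]
    exact hye
  · rw [hq.1, height_eq_cosh]
    rfl

theorem IsProfile.tendsto_meridian {f w : ℝ → ℝ} (hf : IsProfile n f w) (e : E n) {s : ℝ}
    (hs : 0 ≤ s) : Tendsto (meridian f e) (𝓝[Ici 0] s) (𝓝 (meridian f e s)) := by
  have h1 : Tendsto (fun s => ((Real.sinh s • e, Real.cosh s) : L n)) (𝓝[Ici 0] s)
      (𝓝 (Real.sinh s • e, Real.cosh s)) :=
    ((Real.continuous_sinh.smul continuous_const).prodMk Real.continuous_cosh).continuousWithinAt
  exact h1.prodMk_nhds (hf.continuousOn s hs)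

/-- Profiles whose graphs agree near a common point coincide. -/
theorem IsProfile.eqOn_of_graph_eq (hn : 1 ≤ n) {f w f₂ w₂ : ℝ → ℝ} (hf : IsProfile n f w)
    (hf₂ : IsProfile n f₂ w₂) {V : Set (Ambient n)} (hV : IsOpen V) {q : Ambient n} (hqV : q ∈ V)
    (hq : q ∈ radialGraph n f (Ici 0))
    (h : ∀ p ∈ V, p ∈ radialGraph n f (Ici 0) → p ∈ radialGraph n f₂ (Ici 0)) :
    EqOn f f₂ (Ici 0) ∧ EqOn w w₂ (Ioi 0) := by
  obtain ⟨e, he, hqe⟩ := exists_eq_meridian hn hq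
  set s₀ := Real.arsinh ‖q.1.1‖
  have hs₀ : 0 ≤ s₀ := arsinh_norm_nonneg _
  -- Only distances to the right of s₀ are used, so that s₀ = 0 is covered.
  have hev : ∀ᶠ s in 𝓝[>] s₀, meridian f e s ∈ V := by
    refine ((hf.tendsto_meridian e hs₀).mono_left (nhdsWithin_mono _ ?_)).eventually
      (hV.mem_nhds (hqe ▸ hqV))
    exact fun s hs => hs₀.trans (le_of_lt hs)
  obtain ⟨b, hb, hsub⟩ := mem_nhdsGT_iff_exists_Ioo_subset.1 hev
  refine hf.eqOn hf₂ hs₀ hb fun s hs => ?_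
  have hs0 : 0 ≤ s := hs₀.trans hs.1.le
  exact ((meridian_mem_radialGraph_iff he hs0).1
    (h _ (hsub hs) ((meridian_mem_radialGraph_iff he hs0).2 ⟨hs0, rfl⟩))).2

/-- A rotationally symmetric translator that is the graph of `u` near a point is, near that point,
the graph of a rotationally symmetric function. -/
theorem IsRotationInvariant.eventually_eq_radial (hn : 2 ≤ n) {S : Set (Ambient n)}
    (hrot : IsRotationInvariant S) {u : E n → ℝ} {V : Set (Ambient n)} {y₀ e : E n}
    (he : ‖e‖ = 1) (hy₀ : y₀ = ‖y₀‖ • e) (hV : V ∈ 𝓝 (graphMap u y₀)) (hu : ContinuousAt u y₀)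
    (hgraph : ∀ᶠ y in 𝓝 y₀, graphMap u y ∈ S) (hSV : ∀ p ∈ V, p ∈ S → p.2 = u p.1.1) :
    ∀ᶠ y in 𝓝 y₀, u y = u (‖y‖ • e) := by
  have hcont : ContinuousAt (fun y : E n => (((‖y‖ • e, height y), u y) : Ambient n)) y₀ := by
    have h1 : Continuous (fun y : E n => ((‖y‖ • e, height y) : L n)) :=
      (continuous_norm.smul continuous_const).prodMk (contDiff_height (k := 0)).continuous
    exact h1.continuousAt.prodMk hu
  have hV' : V ∈ 𝓝 (((‖y₀‖ • e, height y₀), u y₀) : Ambient n) := by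
    rw [← hy₀]; exact hV
  filter_upwards [hgraph, hcont.eventually hV'] with y h1 h2
  -- Rotating the graph point over y onto the ray of e keeps its t-coordinate and lands in S near
  -- the base point, where S is the graph of u.
  obtain ⟨A, hA, hAy⟩ := exists_rotation hn (x := y) (y := ‖y‖ • e) (by
    rw [norm_smul, he, mul_one, norm_norm])
  have h3 := hrot A hA _ h1
  simp only [graphMap, hAy] at h3
  exact hSV _ h2 h3

theorem eqOn_Ioo_of_hasDerivAt {f₁ f₂ w : ℝ → ℝ} {a b s₁ : ℝ} (hs₁ : s₁ ∈ Ioo a b)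
    (h₁ : ∀ s ∈ Ioo a b, HasDerivAt f₁ (w s) s) (h₂ : ∀ s ∈ Ioo a b, HasDerivAt f₂ (w s) s)
    (heq : f₁ s₁ = f₂ s₁) : EqOn f₁ f₂ (Ioo a b) := by
  intro s hs
  have hd : ∀ s ∈ Ioo a b, HasDerivAt (fun s => f₁ s - f₂ s) 0 s := fun s hs =>
    ((h₁ s hs).sub (h₂ s hs)).congr_deriv (sub_self _)
  have := isOpen_Ioo.is_const_of_deriv_eq_zero isPreconnected_Ioo
    (fun t ht => (hd t ht).differentiableAt.differentiableWithinAt)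
    (fun t ht => (hd t ht).deriv) hs hs₁
  simp only [heq, sub_self] at this
  linarith

/-- A rotationally symmetric translating graph over a ball is a piece of the graph of a profile. -/
theorem exists_profile_of_radial_graph {u : E n → ℝ} {e : E n} {ρ ε : ℝ} (he : ‖e‖ = 1)
    (hρ : 0 ≤ ρ) (hε : 0 < ε) (hu : ContDiffOn ℝ 2 u (Metric.ball (ρ • e) ε))
    (hrad : ∀ y ∈ Metric.ball (ρ • e) ε, u y = u (‖y‖ • e))
    (htr : ∀ y ∈ Metric.ball (ρ • e) ε, SpacelikeAt (graphMap u) y ∧ TranslatorAt (graphMap u) y) :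
    ∃ f w, IsProfile n f w ∧ (∀ y ∈ Metric.ball (ρ • e) ε, u y = f (Real.arsinh ‖y‖)) ∧
      (ρ = 0 → Tendsto w (𝓝[>] 0) (𝓝 0)) := by
  -- The function is defined for negative s as well, along the opposite ray. For ρ = 0 this makes it
  -- C² across the axis.
  set f₀ : ℝ → ℝ := fun s => u (Real.sinh s • e)
  set w₀ : ℝ → ℝ := deriv f₀
  set K : Set ℝ := Ioo (Real.arsinh (ρ - ε)) (Real.arsinh (ρ + ε))
  have hKball : ∀ s ∈ K, Real.sinh s • e ∈ Metric.ball (ρ • e) ε := by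
    intro s hs
    have h1 : ρ - ε < Real.sinh s := by
      have := Real.sinh_strictMono hs.1; rwa [Real.sinh_arsinh] at this
    have h2 : Real.sinh s < ρ + ε := by
      have := Real.sinh_strictMono hs.2; rwa [Real.sinh_arsinh] at this
    rw [mem_ball_iff_norm, ← sub_smul, norm_smul, he, mul_one, Real.norm_eq_abs, abs_lt]
    constructor <;> linarith
  have hballK : ∀ y ∈ Metric.ball (ρ • e) ε, Real.arsinh ‖y‖ ∈ K := by
    intro y hy
    rw [mem_ball_iff_norm] at hy
    have h1 := (abs_norm_sub_norm_le y (ρ • e)).trans_lt hy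
    rw [norm_smul, he, mul_one, Real.norm_of_nonneg hρ, abs_lt] at h1
    exact ⟨Real.arsinh_lt_arsinh.2 (by linarith), Real.arsinh_lt_arsinh.2 (by linarith)⟩
  have hf₀ : ContDiffOn ℝ 2 f₀ K :=
    hu.comp (Real.contDiff_sinh.smul contDiff_const).contDiffOn hKball
  have hf₀d : ∀ s ∈ K, HasDerivAt f₀ (w₀ s) s := fun s hs =>
    ((hf₀.contDiffAt (isOpen_Ioo.mem_nhds hs)).differentiableAt two_ne_zero).hasDerivAt
  have hw₀ : ContDiffOn ℝ 1 w₀ K := hf₀.deriv_of_isOpen isOpen_Ioo (by norm_num)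
  have hw₀d : ∀ s ∈ K, HasDerivAt w₀ (deriv w₀ s) s := fun s hs =>
    ((hw₀.contDiffAt (isOpen_Ioo.mem_nhds hs)).differentiableAt one_ne_zero).hasDerivAt
  have hrad' : ∀ y ∈ Metric.ball (ρ • e) ε, u y = f₀ (Real.arsinh ‖y‖) := fun y hy => by
    simp only [f₀, Real.sinh_arsinh]
    exact hrad y hy
  set a := max 0 (Real.arsinh (ρ - ε))
  set b := Real.arsinh (ρ + ε)
  have hIK : Ioo a b ⊆ K := Ioo_subset_Ioo_left (le_max_right _ _)
  have hI0 : Ioo a b ⊆ Ioi 0 := fun s hs => (le_max_left _ _).trans_lt hs.1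
  have hb0 : 0 < b := Real.arsinh_pos_iff.2 (by linarith)
  have hab : a < b := max_lt hb0 (Real.arsinh_lt_arsinh.2 (by linarith))
  have hslope : IsSlopeOn ((n : ℝ) - 1) w₀ (Ioo a b) := by
    intro s hs
    have hsK := hIK hs
    have hs0 : 0 < s := hI0 hs
    have hball := hKball s hsK
    have hy : Real.sinh s • e ≠ 0 := by
      rw [← norm_ne_zero_iff, norm_sinh_smul he hs0.le]; exact (Real.sinh_pos_iff.2 hs0).ne'
    have hse := arsinh_norm_sinh_smul he hs0.le
    have hev : u =ᶠ[𝓝 (Real.sinh s • e)] fun y => f₀ (Real.arsinh ‖y‖) :=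
      Filter.mem_of_superset (Metric.isOpen_ball.mem_nhds hball) hrad'
    have hfd : ∀ᶠ t in 𝓝 (Real.arsinh ‖Real.sinh s • e‖), HasDerivAt f₀ (w₀ t) t := by
      rw [hse]; exact Filter.mem_of_superset (isOpen_Ioo.mem_nhds hsK) hf₀d
    have h1 := (spacelikeAt_radial_iff hy hfd hev).1 (htr _ hball).1
    have h2 := (translatorAt_radial_iff hy hfd (by rw [hse]; exact hw₀d s hsK) h1 hev).1
      (htr _ hball).2
    rw [hse] at h1 h2
    exact ⟨h1, h2 ▸ hw₀d s hsK⟩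
  set s₁ := (a + b) / 2
  have hs₁ : s₁ ∈ Ioo a b := ⟨by simp only [s₁]; linarith, by simp only [s₁]; linarith⟩
  obtain ⟨w, hw₁, hw⟩ := exists_slope ((n : ℝ) - 1) (hI0 hs₁) (hslope s₁ hs₁).1
  have hww₀ : EqOn w w₀ (Ioo a b) :=
    (hw.mono hI0).eqOn isOpen_Ioo ordConnected_Ioo hI0 hslope hs₁ hw₁
  obtain ⟨f, hf₁, hf⟩ := hw.exists_isProfile (le_of_lt (hI0 hs₁)) (f₀ s₁)
  have hff₀ : EqOn f f₀ (Ioo a b) :=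
    eqOn_Ioo_of_hasDerivAt hs₁ (fun s hs => hf.hasDerivAt s (hI0 hs))
      (fun s hs => hww₀ hs ▸ hf₀d s (hIK hs)) hf₁
  -- The differential equations hold for s > 0; continuity adds the endpoint s = 0.
  have hff₀' : EqOn f f₀ (K ∩ Ici 0) := by
    refine hff₀.of_subset_closure (hf.continuousOn.mono inter_subset_right)
      (hf₀.continuousOn.mono inter_subset_left) (fun s hs => ⟨hIK hs, mem_Ici.2 (le_of_lt (hI0 hs))⟩) ?_
    rw [closure_Ioo hab.ne]
    exact fun s hs => ⟨max_le hs.2 hs.1.1.le, hs.1.2.le⟩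
  refine ⟨f, w, hf, fun y hy => ?_, ?_⟩
  · rw [hrad' y hy, hff₀' ⟨hballK y hy, arsinh_norm_nonneg y⟩]
  · rintro rfl
    have h0K : (0 : ℝ) ∈ K := ⟨Real.arsinh_neg_iff.2 (by linarith), hb0⟩
    have hKsymm : ∀ s ∈ K, f₀ (-s) = f₀ s := by
      intro s hs
      have hs' : -s ∈ K := by
        have h1 : Real.arsinh (0 - ε) = -b := by
          rw [zero_sub, Real.arsinh_neg]; simp [b]
        rw [mem_Ioo, h1] at hs ⊢
        constructor <;> linarith [hs.1, hs.2]
      have h1 := hrad _ (hKball s hs)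
      have h2 := hrad _ (hKball _ hs')
      simp only [f₀]
      rw [h1, h2, Real.sinh_neg, neg_smul, norm_neg]
    -- An even differentiable function has derivative 0 at 0.
    have hd0 : w₀ 0 = 0 := by
      have h1 : HasDerivAt (fun s => f₀ (-s)) (-w₀ 0) 0 := by
        have h : HasDerivAt f₀ (w₀ 0) (-0) := by rw [neg_zero]; exact hf₀d 0 h0K
        exact (h.scomp 0 (hasDerivAt_neg 0)).congr_deriv (by simp)
      have h2 := h1.congr_of_eventuallyEq (f₁ := f₀)
        (Filter.mem_of_superset (isOpen_Ioo.mem_nhds h0K) fun s hs => (hKsymm s hs).symm)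
      linarith [(hf₀d 0 h0K).unique h2]
    have hlim : Tendsto w₀ (𝓝[>] 0) (𝓝 0) := by
      have := (hw₀d 0 h0K).continuousAt.tendsto
      rw [hd0] at this
      exact this.mono_left nhdsWithin_le_nhds
    have ha0 : a = 0 := max_eq_left h0K.1.le
    refine hlim.congr' ?_
    rw [ha0] at hww₀
    exact Filter.mem_of_superset (Ioo_mem_nhdsGT hb0) hww₀.symm

/-- Near each of its points, a rotationally symmetric translator is the graph of a profile. -/
theorem IsSpacelikeTranslator.exists_local_profile (hn : 2 ≤ n) {S : Set (Ambient n)}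
    (hrot : IsRotationInvariant S) (hS : IsSpacelikeTranslator 2 S) {q : Ambient n} (hq : q ∈ S) :
    ∃ f w, IsProfile n f w ∧ (q.1.1 = 0 → Tendsto w (𝓝[>] 0) (𝓝 0)) ∧
      ∃ V, IsOpen V ∧ q ∈ V ∧ ∀ p ∈ V, (p ∈ S ↔ p ∈ radialGraph n f (Ici 0)) := by
  obtain ⟨u, W, V, hW, hqW, hV, hqV, hu, hgr, hSV⟩ := hS.exists_local_graph hq
  obtain ⟨e, he, hqe⟩ := exists_unit_smul_eq (by omega) q.1.1
  have hqgr : graphMap u q.1.1 = q :=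
    Prod.ext (Prod.ext rfl (mem_hyp_iff.1 (hS.1 hq)).symm) ((hSV q hqV).2.1 hq).2.symm
  have hrad := hrot.eventually_eq_radial hn he hqe (V := V) (by rw [hqgr]; exact hV.mem_nhds hqV)
    (hu.continuousOn.continuousAt (hW.mem_nhds hqW))
    (Filter.mem_of_superset (hW.mem_nhds hqW) fun y hy => (hgr y hy).1)
    (fun p hp hpS => ((hSV p hp).2.1 hpS).2)
  obtain ⟨ε, hε, hball⟩ := Metric.mem_nhds_iff.1 (Filter.inter_mem (hW.mem_nhds hqW) hrad)
  rw [hqe] at hball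
  obtain ⟨f, w, hf, huf, hlim⟩ := exists_profile_of_radial_graph he (norm_nonneg q.1.1) hε
    (hu.mono fun y hy => (hball hy).1) (fun y hy => (hball hy).2)
    (fun y hy => (hgr y (hball hy).1).2)
  rw [← hqe] at huf
  refine ⟨f, w, hf, fun h => hlim (by rw [h, norm_zero]), V ∩ (fun p => p.1.1) ⁻¹' Metric.ball q.1.1 ε,
    hV.inter (Metric.isOpen_ball.preimage (by fun_prop)), ⟨hqV, Metric.mem_ball_self hε⟩, ?_⟩
  rintro p ⟨hpV, hpb⟩
  rw [(hSV p hpV).2, mem_radialGraph_iff, huf _ hpb]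
  simp

/-! ### Classification of connected translators -/

/-- Connected rotationally symmetric translators are pieces of graphs of profiles. -/
theorem IsSpacelikeTranslator.exists_profile (hn : 2 ≤ n) {S : Set (Ambient n)}
    (hconn : IsConnected S) (hrot : IsRotationInvariant S) (hS : IsSpacelikeTranslator 2 S) :
    ∃ f w, IsProfile n f w ∧ (∀ q ∈ S, q.1.1 = 0 → Tendsto w (𝓝[>] 0) (𝓝 0)) ∧
      ∀ q ∈ S, ∃ V, IsOpen V ∧ q ∈ V ∧ ∀ p ∈ V, (p ∈ S ↔ p ∈ radialGraph n f (Ici 0)) := by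
  obtain ⟨q₀, hq₀⟩ := hconn.nonempty
  obtain ⟨f, w, hf, -, V₀, hV₀, hqV₀, hSV₀⟩ := hS.exists_local_profile hn hrot hq₀
  -- `O₁` is where S is locally the graph of f, `O₂` where it is locally the graph of another
  -- profile. Both are open, they cover S, and unique continuation forbids a common point in S.
  set O₁ : Set (Ambient n) := ⋃₀ {V | IsOpen V ∧ ∀ p ∈ V, (p ∈ S ↔ p ∈ radialGraph n f (Ici 0))}
  set O₂ : Set (Ambient n) := ⋃₀ {V | IsOpen V ∧ ∃ f₂ w₂, IsProfile n f₂ w₂ ∧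
    ¬ EqOn f f₂ (Ici 0) ∧ ∀ p ∈ V, (p ∈ S ↔ p ∈ radialGraph n f₂ (Ici 0))}
  have hcover : ∀ q ∈ S, ∀ f₂ w₂, IsProfile n f₂ w₂ →
      (∃ V, IsOpen V ∧ q ∈ V ∧ ∀ p ∈ V, (p ∈ S ↔ p ∈ radialGraph n f₂ (Ici 0))) →
      EqOn f f₂ (Ici 0) → q ∈ O₁ := by
    rintro q - f₂ w₂ - ⟨V, hV, hqV, hSV⟩ heq
    refine ⟨V, ⟨hV, fun p hp => ?_⟩, hqV⟩
    rw [hSV p hp, mem_radialGraph_iff, mem_radialGraph_iff, heq (mem_Ici.2 (arsinh_norm_nonneg _))]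
  have hsub : S ⊆ O₁ := by
    by_contra hnot
    obtain ⟨q, hqS, hqO⟩ := not_subset.1 hnot
    have hO : S ⊆ O₁ ∪ O₂ := by
      intro q hq
      obtain ⟨f₂, w₂, hf₂, -, V, hV, hqV, hSV⟩ := hS.exists_local_profile hn hrot hq
      by_cases heq : EqOn f f₂ (Ici 0)
      · exact .inl (hcover q hq f₂ w₂ hf₂ ⟨V, hV, hqV, hSV⟩ heq)
      · exact .inr ⟨V, ⟨hV, f₂, w₂, hf₂, heq, hSV⟩, hqV⟩
    obtain ⟨p, hpS, ⟨V₁, ⟨hV₁, hSV₁⟩, hpV₁⟩, V₂, ⟨hV₂, f₂, w₂, hf₂, hne, hSV₂⟩, hpV₂⟩ :=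
      hconn.isPreconnected O₁ O₂ (isOpen_sUnion fun V hV => hV.1) (isOpen_sUnion fun V hV => hV.1)
        hO ⟨q₀, hq₀, V₀, ⟨hV₀, hSV₀⟩, hqV₀⟩ ⟨q, hqS, (hO hqS).resolve_left hqO⟩
    refine hne (hf.eqOn_of_graph_eq (by omega) hf₂ (hV₁.inter hV₂) ⟨hpV₁, hpV₂⟩
      ((hSV₁ p hpV₁).1 hpS) fun p' hp' h => ?_).1
    exact (hSV₂ p' hp'.2).1 ((hSV₁ p' hp'.1).2 h)
  have hloc : ∀ q ∈ S, ∃ V, IsOpen V ∧ q ∈ V ∧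
      ∀ p ∈ V, (p ∈ S ↔ p ∈ radialGraph n f (Ici 0)) := by
    intro q hq
    obtain ⟨V, ⟨hV, hSV⟩, hqV⟩ := hsub hq
    exact ⟨V, hV, hqV, hSV⟩
  refine ⟨f, w, hf, fun q hq h0 => ?_, hloc⟩
  obtain ⟨f₂, w₂, hf₂, hlim, V₂, hV₂, hqV₂, hSV₂⟩ := hS.exists_local_profile hn hrot hq
  obtain ⟨V₁, hV₁, hqV₁, hSV₁⟩ := hloc q hq
  have heq := (hf.eqOn_of_graph_eq (by omega) hf₂ (hV₁.inter hV₂) ⟨hqV₁, hqV₂⟩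
    ((hSV₁ q hqV₁).1 hq) fun p' hp' h => (hSV₂ p' hp'.2).1 ((hSV₁ p' hp'.1).2 h)).2
  exact (hlim h0).congr' (Filter.mem_of_superset self_mem_nhdsWithin heq.symm)

theorem IsSpacelikeTranslator.classification (hn : 2 ≤ n) {S : Set (Ambient n)}
    (hconn : IsConnected S) (hrot : IsRotationInvariant S) (hS : IsSpacelikeTranslator 2 S) :
    ∃ (f w : ℝ → ℝ) (J : Set ℝ), IsProfile n f w ∧
      J.OrdConnected ∧ (∃ O : Set ℝ, IsOpen O ∧ J = O ∩ Ici 0) ∧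
      S = radialGraph n f J ∧
      (0 ∈ J → Tendsto w (𝓝[>] 0) (𝓝 0)) ∧
      ∀ f' w' : ℝ → ℝ, IsProfile n f' w' → S ⊆ radialGraph n f' (Ici 0) →
        EqOn f' f (Ici 0) ∧ EqOn w' w (Ioi 0) := by
  obtain ⟨f, w, hf, hlim, hloc⟩ := hS.exists_profile hn hconn hrot
  have hn1 : 1 ≤ n := by omega
  have hsub : S ⊆ radialGraph n f (Ici 0) := fun q hq => by
    obtain ⟨V, -, hqV, hSV⟩ := hloc q hq
    exact (hSV q hqV).1 hq
  have hcont : Continuous fun q : Ambient n => Real.arsinh ‖q.1.1‖ :=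
    Real.continuous_arsinh.comp (by fun_prop)
  set J : Set ℝ := (fun q : Ambient n => Real.arsinh ‖q.1.1‖) '' S
  have hJ0 : ∀ s ∈ J, 0 ≤ s := by
    rintro _ ⟨q, -, rfl⟩
    exact arsinh_norm_nonneg _
  have hJ : ∀ s ∈ J, J ∈ 𝓝[Ici 0] s := by
    rintro _ ⟨q, hq, rfl⟩
    obtain ⟨V, hV, hqV, hSV⟩ := hloc q hq
    obtain ⟨e, he, hqe⟩ := exists_eq_meridian hn1 (hsub hq)
    have h1 := (hf.tendsto_meridian e (arsinh_norm_nonneg q.1.1)).eventually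
      (hV.mem_nhds (hqe ▸ hqV))
    filter_upwards [h1, self_mem_nhdsWithin] with s hs hs0
    exact ⟨_, (hSV _ hs).2 ((meridian_mem_radialGraph_iff he hs0).2 ⟨hs0, rfl⟩),
      arsinh_norm_sinh_smul he hs0⟩
  -- Adding the negative half-line turns a relatively open set into an open one.
  refine ⟨f, w, J, hf, ?_, ⟨J ∪ Iio 0, ?_, ?_⟩, ?_, ?_, ?_⟩
  · exact (hconn.isPreconnected.image _ hcont.continuousOn).ordConnected
  · refine isOpen_iff_mem_nhds.2 ?_
    rintro s (hs | hs)
    · have := hJ s hs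
      rw [mem_nhdsWithin_iff_exists_mem_nhds_inter] at this
      obtain ⟨N, hN, hNJ⟩ := this
      refine Filter.mem_of_superset hN fun t ht => ?_
      rcases lt_or_ge t 0 with h | h
      · exact .inr h
      · exact .inl (hNJ ⟨ht, h⟩)
    · exact Filter.mem_of_superset (isOpen_Iio.mem_nhds hs) subset_union_right
  · ext s
    constructor
    · exact fun hs => ⟨.inl hs, hJ0 s hs⟩
    · rintro ⟨hs | hs, h0⟩
      · exact hs
      · exact absurd (mem_Iio.1 hs) (not_lt.2 h0)
  · ext p
    rw [mem_radialGraph_iff]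
    constructor
    · intro hp
      have h := mem_radialGraph_iff.1 (hsub hp)
      exact ⟨h.1, mem_image_of_mem _ hp, h.2.2⟩
    · rintro ⟨h1, ⟨q, hq, hqp⟩, h3⟩
      have hq' := mem_radialGraph_iff.1 (hsub hq)
      have hnorm : ‖q.1.1‖ = ‖p.1.1‖ := Real.arsinh_injective hqp
      -- One point of S at a given distance yields the whole sphere of the graph at that distance.
      obtain ⟨A, hA, hAq⟩ := exists_rotation hn hnorm
      have := hrot A hA q hq
      convert this using 1
      refine Prod.ext (Prod.ext hAq.symm ?_) ?_
      · simp only [mem_hyp_iff.1 h1, mem_hyp_iff.1 hq'.1, height, hnorm]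
      · simp only [h3, hq'.2.2, hnorm]
  · rintro ⟨q, hq, hq0⟩
    exact hlim q hq (norm_eq_zero.1 (Real.arsinh_eq_zero_iff.1 hq0))
  · intro f' w' hf' hsub'
    obtain ⟨q, hq⟩ := hconn.nonempty
    obtain ⟨V, hV, hqV, hSV⟩ := hloc q hq
    have := hf.eqOn_of_graph_eq hn1 hf' hV hqV (hsub hq) fun p hp h => hsub' ((hSV p hp).2 h)
    exact ⟨this.1.symm, this.2.symm⟩

/-! ### Regularity at the axis -/

section ParametricIntegral

theorem hasFDerivAt_integral_pow_smul {V F : Type} [NormedAddCommGroup V] [NormedSpace ℝ V]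
    [ProperSpace V] [NormedAddCommGroup F] [NormedSpace ℝ F] [CompleteSpace F] {h : V → F}
    (hh : ContDiff ℝ 1 h) (j : ℕ) (y : V) :
    HasFDerivAt (fun y => ∫ t in (0 : ℝ)..1, t ^ j • h (t • y))
      (∫ t in (0 : ℝ)..1, t ^ (j + 1) • fderiv ℝ h (t • y)) y := by
  have hc : Continuous h := hh.continuous
  have hc' : Continuous (fderiv ℝ h) := hh.continuous_fderiv one_ne_zero
  obtain ⟨C, hC⟩ := (isCompact_closedBall (0 : V) (‖y‖ + 1)).exists_bound_of_continuousOn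
    hc'.continuousOn
  have hcont : ∀ x, Continuous fun t : ℝ => t ^ j • h (t • x) := fun x => by fun_prop
  have hcont' : Continuous fun t : ℝ => t ^ (j + 1) • fderiv ℝ h (t • y) := by fun_prop
  refine intervalIntegral.hasFDerivAt_integral_of_dominated_of_fderiv_le
    (F := fun y t => t ^ j • h (t • y)) (F' := fun y t => t ^ (j + 1) • fderiv ℝ h (t • y))
    (s := Metric.ball y 1) (bound := fun _ => C) (Metric.ball_mem_nhds y one_pos)
    (.of_forall fun x => (hcont x).aestronglyMeasurable) ((hcont y).intervalIntegrable _ _)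
    hcont'.aestronglyMeasurable (.of_forall fun t ht x hx => ?_) intervalIntegrable_const
    (.of_forall fun t _ x _ => ?_)
  · rw [uIoc_of_le zero_le_one] at ht
    have hx' : ‖x‖ ≤ ‖y‖ + 1 := by
      rw [mem_ball_iff_norm] at hx
      linarith [norm_le_norm_add_norm_sub' x y]
    have htx : t • x ∈ Metric.closedBall (0 : V) (‖y‖ + 1) := by
      rw [mem_closedBall_zero_iff, norm_smul, Real.norm_of_nonneg ht.1.le]
      exact (mul_le_of_le_one_left (norm_nonneg _) ht.2).trans hx'
    rw [norm_smul, Real.norm_of_nonneg (pow_nonneg ht.1.le _)]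
    exact (mul_le_of_le_one_left (norm_nonneg _) (pow_le_one₀ ht.1.le ht.2)).trans (hC _ htx)
  · have h1 : HasFDerivAt h (fderiv ℝ h (t • x)) (t • x) :=
      (hh.differentiable one_ne_zero _).hasFDerivAt
    have h2 : HasFDerivAt (fun x : V => t • x) (t • ContinuousLinearMap.id ℝ V) x :=
      (hasFDerivAt_id x).const_smul t
    refine ((h1.comp x h2).const_smul (t ^ j)).congr_fderiv ?_
    ext v
    simp [pow_succ, smul_smul]

/-- Differentiation raises the exponent j and replaces the target by a space of linear maps, so the
induction quantifies over both. -/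
theorem contDiff_integral_pow_smul {V : Type} [NormedAddCommGroup V] [NormedSpace ℝ V]
    [ProperSpace V] (k : ℕ) : ∀ {F : Type} [NormedAddCommGroup F] [NormedSpace ℝ F]
      [CompleteSpace F] {h : V → F} (_ : ContDiff ℝ k h) (j : ℕ),
      ContDiff ℝ k (fun y => ∫ t in (0 : ℝ)..1, t ^ j • h (t • y)) := by
  induction k with
  | zero =>
    intro F _ _ _ h hh j
    have hc : Continuous h := hh.continuous
    refine contDiff_zero.2
      (intervalIntegral.continuous_parametric_intervalIntegral_of_continuous' ?_ 0 1)
    simp only [Function.uncurry_def]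
    fun_prop
  | succ k ih =>
    intro F _ _ _ h hh j
    have h1 : ContDiff ℝ 1 h := hh.of_le (by norm_cast; omega)
    have hd := hasFDerivAt_integral_pow_smul h1 j
    have h2 : ContDiff ℝ k (fderiv ℝ h) := hh.fderiv_right (by norm_cast)
    push_cast
    refine contDiff_succ_iff_fderiv.2 ⟨fun y => (hd y).differentiableAt, by simp, ?_⟩
    rw [funext fun y => (hd y).fderiv]
    exact ih h2 (j + 1)

end ParametricIntegral

theorem contDiff_norm_sq' {k : WithTop ℕ∞} : ContDiff ℝ k fun y : E n => ‖y‖ ^ 2 :=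
  contDiff_norm_sq ℝ

/-- The nonlinear term of the equation for `p = 2 du/dz` at `z = 0`. -/
noncomputable def axisTerm (m z p : ℝ) : ℝ := -(p + 1) / (1 + z) + m * (1 + z) * p ^ 3 - p ^ 2

/-- All terms other than the singular linear part z q + (m + 1) p and the constant 1 carry a factor
z. -/
theorem radialEquation_iff_axisTerm {m z p q : ℝ} (hz : 0 ≤ z) :
    RadialEquation m z p q ↔ z * q + (m + 1) * p = 1 + z * axisTerm m z p := by
  rw [RadialEquation, axisTerm, ← sub_eq_zero (a := z * q + (m + 1) * p)]
  have : 1 + z ≠ 0 := by positivity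
  refine iff_of_eq (congrArg (· = 0) ?_)
  field_simp
  ring

section Axis

variable {P : E n → ℝ} {m : ℝ}

/-- Along a ray ‖y‖² q is the Euler derivative of P, and tⁿ is the integrating factor of the left
side of the equation. -/
theorem hasDerivAt_pow_mul_sub (hn : 2 ≤ n) (hb : ∀ y, |P y| ≤ 1) {h : E n → ℝ}
    (hP : ∀ y, y ≠ 0 → ∃ q, HasRadialDerivAt P q y ∧ ‖y‖ ^ 2 * q + n * P y = 1 + ‖y‖ ^ 2 * h y)
    {y : E n} (hy : y ≠ 0) (t : ℝ) :
    HasDerivAt (fun t => t ^ n * (P (t • y) - 1 / n)) (‖y‖ ^ 2 * (t ^ (n + 1) * h (t • y))) t := by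
  have hn0 : (n : ℝ) ≠ 0 := by positivity
  rcases eq_or_ne t 0 with rfl | ht
  -- At t = 0 no equation is available; boundedness of P and n ≥ 2 give the vanishing derivative.
  · have hO : (fun t => t ^ n * (P (t • y) - 1 / n)) =O[𝓝 0] fun t : ℝ => ‖t - 0‖ ^ n := by
      refine Asymptotics.IsBigO.of_bound 2 (.of_forall fun t => ?_)
      have h1 : |P (t • y) - 1 / n| ≤ 2 := by
        have h2 : 1 / (n : ℝ) ≤ 1 := by
          rw [div_le_one (by positivity)]; exact_mod_cast (by omega : 1 ≤ n)
        have h3 : 0 ≤ 1 / (n : ℝ) := by positivity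
        have := abs_le.1 (hb (t • y))
        rw [abs_le]
        constructor <;> linarith
      rw [norm_mul, sub_zero, norm_pow, norm_pow, norm_norm, mul_comm]
      exact mul_le_mul_of_nonneg_right h1 (by positivity)
    have := (hO.hasFDerivAt (by omega)).hasDerivAt
    simpa using this
  · obtain ⟨q, hq, heq⟩ := hP (t • y) (smul_ne_zero ht hy)
    have h1 : HasDerivAt (fun t : ℝ => t • y) y t := by
      simpa using (hasDerivAt_id t).smul_const y
    have hq' : HasFDerivAt P (q • innerSL ℝ (t • y)) ((fun t : ℝ => t • y) t) := hq
    have h2 : HasDerivAt (fun t : ℝ => P (t • y)) (q * inner ℝ (t • y) y) t :=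
      hq'.comp_hasDerivAt (f := fun t : ℝ => t • y) t h1
    refine ((hasDerivAt_pow n t).mul (h2.sub_const (1 / (n : ℝ)))).congr_deriv ?_
    have hpow : t ^ n = t ^ (n - 1) * t := (pow_sub_one_mul (by omega) t).symm
    have hns : ‖t • y‖ ^ 2 = t ^ 2 * ‖y‖ ^ 2 := by
      rw [norm_smul, mul_pow, Real.norm_eq_abs, sq_abs]
    rw [hns] at heq
    rw [real_inner_smul_left, real_inner_self_eq_norm_sq, pow_succ t n, hpow]
    have hinv : (n : ℝ) * (1 / n) = 1 := by field_simp
    linear_combination t ^ (n - 1) * heq - t ^ (n - 1) * hinv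

/-- Bounded solutions of the singular equation at the axis are smooth. -/
theorem contDiff_of_axis_equation (hn : 2 ≤ n) (hb : ∀ y, |P y| ≤ 1) (h0 : P 0 = 1 / n)
    (hP : ∀ y, y ≠ 0 → ∃ q, HasRadialDerivAt P q y ∧
      ‖y‖ ^ 2 * q + n * P y = 1 + ‖y‖ ^ 2 * axisTerm m (‖y‖ ^ 2) (P y)) :
    ContDiff ℝ ∞ P ∧ ∃ q : E n → ℝ, ∀ y, HasRadialDerivAt P (q y) y := by
  have hn0 : (n : ℝ) ≠ 0 := by positivity
  set h : E n → ℝ := fun y => axisTerm m (‖y‖ ^ 2) (P y) with hh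
  have hΦ := fun {y : E n} (hy : y ≠ 0) (t : ℝ) =>
    hasDerivAt_pow_mul_sub hn hb (h := h) hP hy t
  have hbound : ∀ y : E n, ‖y‖ ≤ 1 → |h y| ≤ 3 + 2 * |m| := by
    intro y hy
    have h1 : ‖y‖ ^ 2 ≤ 1 := pow_le_one₀ (norm_nonneg y) hy
    have h1' : 0 ≤ ‖y‖ ^ 2 := by positivity
    have h2 := hb y
    have e1 : |-(P y + 1) / (1 + ‖y‖ ^ 2)| ≤ 2 := by
      rw [abs_div, abs_neg, div_le_iff₀ (by positivity), abs_of_pos (by positivity : 0 < 1 + ‖y‖ ^ 2)]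
      have : |P y + 1| ≤ 2 := by
        rw [abs_le] at h2 ⊢; constructor <;> linarith [h2.1, h2.2]
      linarith
    have e2 : |m * (1 + ‖y‖ ^ 2) * P y ^ 3| ≤ 2 * |m| := by
      rw [abs_mul, abs_mul, abs_pow, abs_of_pos (by positivity : 0 < 1 + ‖y‖ ^ 2)]
      have e3 : |P y| ^ 3 ≤ 1 := pow_le_one₀ (abs_nonneg _) h2
      have e4 : |m| * (1 + ‖y‖ ^ 2) ≤ 2 * |m| := by nlinarith [abs_nonneg m]
      calc _ ≤ |m| * (1 + ‖y‖ ^ 2) * 1 := by gcongr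
        _ ≤ _ := by linarith
    have e3 : |P y ^ 2| ≤ 1 := by
      rw [abs_pow]; exact pow_le_one₀ (abs_nonneg _) h2
    simp only [hh, axisTerm]
    refine (abs_sub _ _).trans ?_
    have := abs_add_le (-(P y + 1) / (1 + ‖y‖ ^ 2)) (m * (1 + ‖y‖ ^ 2) * P y ^ 3)
    linarith
  -- The mean value inequality along the ray turns the bound on h into quadratic decay, hence
  -- differentiability of P at 0.
  have hquad : ∀ y : E n, ‖y‖ ≤ 1 → |P y - P 0| ≤ (3 + 2 * |m|) * ‖y‖ ^ 2 := by
    intro y hy1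
    rcases eq_or_ne y 0 with rfl | hy
    · simp
    have := norm_image_sub_le_of_norm_deriv_le_segment' (a := (0 : ℝ)) (b := 1)
      (f := fun t => t ^ n * (P (t • y) - 1 / n))
      (C := (3 + 2 * |m|) * ‖y‖ ^ 2) (fun t _ => (hΦ hy t).hasDerivWithinAt) ?_ 1 (by simp)
    · have hn' : n ≠ 0 := by omega
      simpa [h0, hn'] using this
    · intro t ht
      have h1 : ‖t • y‖ ≤ 1 := by
        rw [norm_smul, Real.norm_of_nonneg ht.1]
        exact mul_le_one₀ ht.2.le (norm_nonneg y) hy1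
      rw [norm_mul, norm_mul, norm_pow, norm_pow, norm_norm, mul_comm, Real.norm_eq_abs,
        Real.norm_eq_abs (h _)]
      refine mul_le_mul_of_nonneg_right ?_ (by positivity)
      have h2 : |t| ^ (n + 1) ≤ 1 := pow_le_one₀ (abs_nonneg _) (by rw [abs_of_nonneg ht.1]; exact ht.2.le)
      exact (mul_le_of_le_one_left (abs_nonneg _) h2).trans (hbound _ h1)
  have hd0 : HasFDerivAt P (0 : E n →L[ℝ] ℝ) 0 := by
    have hO : (fun y => P y - P 0) =O[𝓝 0] fun y : E n => ‖y - 0‖ ^ 2 := by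
      refine Asymptotics.IsBigO.of_bound (3 + 2 * |m|) ?_
      filter_upwards [Metric.closedBall_mem_nhds (0 : E n) one_pos] with y hy
      rw [mem_closedBall_zero_iff] at hy
      rw [sub_zero, norm_pow, norm_norm]
      exact hquad y hy
    refine ((hO.hasFDerivAt (𝕜 := ℝ) one_lt_two).add_const (P 0)).congr_of_eventuallyEq ?_
    exact .of_forall fun y => (sub_add_cancel _ _).symm
  have hdiff : Differentiable ℝ P := by
    intro y
    rcases eq_or_ne y 0 with rfl | hy
    · exact hd0.differentiableAt
    · obtain ⟨q, hq, -⟩ := hP y hy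
      exact HasFDerivAt.differentiableAt hq
  have hcd : ∀ {k : ℕ}, ContDiff ℝ k P → ContDiff ℝ k h := by
    intro k hk
    have hz : ContDiff ℝ k fun y : E n => ‖y‖ ^ 2 := contDiff_norm_sq'
    exact (((hk.add contDiff_const).neg.div (contDiff_const.add hz) fun y => by positivity).add
      ((contDiff_const.mul (contDiff_const.add hz)).mul (hk.pow 3))).sub (hk.pow 2)
  have hhc : Continuous h := (hcd (k := 0) (contDiff_zero.2 hdiff.continuous)).continuous
  set γ : E n → ℝ := fun y => ∫ t in (0 : ℝ)..1, t ^ (n + 1) • h (t • y) with hγ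
  have hPγ : ∀ y, P y - 1 / n = ‖y‖ ^ 2 * γ y := by
    intro y
    rcases eq_or_ne y 0 with rfl | hy
    · simp [h0]
    have hint : Continuous fun t : ℝ => ‖y‖ ^ 2 * (t ^ (n + 1) * h (t • y)) := by fun_prop
    have := intervalIntegral.integral_eq_sub_of_hasDerivAt (a := 0) (b := 1)
      (fun t _ => hΦ hy t) (hint.intervalIntegrable _ _)
    rw [intervalIntegral.integral_const_mul] at this
    have hn' : n ≠ 0 := by omega
    simp only [one_pow, one_smul, one_mul, zero_pow hn', zero_mul, sub_zero] at this
    exact this.symm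
  -- Dividing by ‖y‖² gives q in terms of h and its ray average γ, with no derivative of P. If P is
  -- Cᵏ, so is dP, and the induction below gains one order each time.
  have hfd : ∀ y, HasRadialDerivAt P (h y - n * γ y) y := by
    intro y
    rcases eq_or_ne y 0 with rfl | hy
    · exact hd0.congr_fderiv (by ext; simp)
    · obtain ⟨q, hq, heq⟩ := hP y hy
      have hy2 : ‖y‖ ^ 2 ≠ 0 := pow_ne_zero 2 (norm_ne_zero_iff.2 hy)
      have : q = h y - n * γ y := by
        apply mul_left_cancel₀ hy2
        have hinv : (n : ℝ) * (1 / n) = 1 := by field_simp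
        linear_combination heq - n * hPγ y - hinv
      rwa [← this]
  refine ⟨contDiff_infty.2 fun k => ?_, _, hfd⟩
  induction k with
  | zero => exact contDiff_zero.2 hdiff.continuous
  | succ k ih =>
    push_cast
    refine contDiff_succ_iff_fderiv.2 ⟨hdiff, by simp, ?_⟩
    rw [funext fun y => (hfd y).fderiv]
    have h1 : ContDiff ℝ k fun y => h y - n * γ y :=
      (hcd ih).sub (contDiff_const.mul (contDiff_integral_pow_smul k (hcd ih) (n + 1)))
    exact h1.smul (innerSL ℝ).contDiff

end Axis

/-! ### Graphs of profiles as translators, and the bowl -/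

theorem isLocalParam_graphMap {k : WithTop ℕ∞} (hk : k ≠ 0) {u : E n → ℝ} {W : Set (E n)}
    (hW : IsOpen W) (hu : ContDiffOn ℝ k u W) :
    IsLocalParam k {q : Ambient n | q.1 ∈ hyp n ∧ q.1.1 ∈ W ∧ q.2 = u q.1.1} W (graphMap u) where
  isOpen := hW
  contDiffOn := (contDiff_id.prodMk contDiff_height).contDiffOn.prodMk hu
  immersion := by
    intro y hy v w hvw
    have hd := ((hu.contDiffAt (hW.mem_nhds hy)).differentiableAt hk).hasFDerivAt
    rw [(hasFDerivAt_graphMap hd).fderiv] at hvw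
    exact congrArg (fun q : Ambient n => q.1.1) hvw
  isEmbedding := by
    have hc : ContinuousOn (graphMap u) W :=
      ((contDiff_id.prodMk (contDiff_height (k := 0))).continuous.continuousOn).prodMk hu.continuousOn
    refine IsEmbedding.of_comp (g := fun q : Ambient n => q.1.1)
      (continuousOn_iff_continuous_domRestrict.1 hc) (by fun_prop) ?_
    exact IsEmbedding.subtypeVal
  image_eq := by
    refine ⟨univ, isOpen_univ, ?_⟩
    rw [inter_univ]
    ext q
    constructor
    · rintro ⟨y, hy, rfl⟩
      exact ⟨fst_graphMap_mem_hyp u y, hy, rfl⟩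
    · rintro ⟨h1, h2, h3⟩
      exact ⟨q.1.1, h2, Prod.ext (Prod.ext rfl (mem_hyp_iff.1 h1).symm) h3.symm⟩

theorem isSpacelikeTranslator_graph {k : WithTop ℕ∞} (hk : k ≠ 0) {u : E n → ℝ} {W : Set (E n)}
    (hW : IsOpen W) (hu : ContDiffOn ℝ k u W)
    (h : ∀ y ∈ W, SpacelikeAt (graphMap u) y ∧ TranslatorAt (graphMap u) y) :
    IsSpacelikeTranslator k {q : Ambient n | q.1 ∈ hyp n ∧ q.1.1 ∈ W ∧ q.2 = u q.1.1} := by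
  refine ⟨fun q hq => hq.1, fun q hq => ⟨W, graphMap u, isLocalParam_graphMap hk hW hu, ?_, h⟩⟩
  exact ⟨q.1.1, hq.2.1, Prod.ext (Prod.ext rfl (mem_hyp_iff.1 hq.1).symm) hq.2.2.symm⟩

theorem radialGraph_Ici_eq (f : ℝ → ℝ) : radialGraph n f (Ici 0) =
    {q : Ambient n | q.1 ∈ hyp n ∧ q.1.1 ∈ univ ∧ q.2 = f (Real.arsinh ‖q.1.1‖)} := by
  ext q
  simp [mem_radialGraph_iff]

theorem radialGraph_Ioi_eq (f : ℝ → ℝ) : radialGraph n f (Ioi 0) =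
    {q : Ambient n | q.1 ∈ hyp n ∧ q.1.1 ∈ ({0}ᶜ : Set (E n)) ∧ q.2 = f (Real.arsinh ‖q.1.1‖)} := by
  ext q
  simp [mem_radialGraph_iff, Real.arsinh_pos_iff]

theorem isRotationInvariant_radialGraph (f : ℝ → ℝ) (J : Set ℝ) :
    IsRotationInvariant (radialGraph n f J) := by
  rintro A - q hq
  rw [mem_radialGraph_iff, mem_hyp_iff] at hq ⊢
  simpa [height, A.norm_map] using hq

theorem isConnected_graph {u : E n → ℝ} {W : Set (E n)} (hW : IsConnected W)
    (hu : ContinuousOn u W) :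
    IsConnected {q : Ambient n | q.1 ∈ hyp n ∧ q.1.1 ∈ W ∧ q.2 = u q.1.1} := by
  have hc : ContinuousOn (graphMap u) W :=
    ((contDiff_id.prodMk (contDiff_height (k := 0))).continuous.continuousOn).prodMk hu
  convert hW.image _ hc using 1
  ext q
  constructor
  · rintro ⟨h1, h2, h3⟩
    exact ⟨q.1.1, h2, Prod.ext (Prod.ext rfl (mem_hyp_iff.1 h1).symm) h3.symm⟩
  · rintro ⟨y, hy, rfl⟩
    exact ⟨fst_graphMap_mem_hyp u y, hy, rfl⟩

theorem IsProfile.continuous_comp_arsinh {f w : ℝ → ℝ} (hf : IsProfile n f w) :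
    Continuous fun y : E n => f (Real.arsinh ‖y‖) :=
  hf.continuousOn.comp_continuous (Real.continuous_arsinh.comp continuous_norm) arsinh_norm_nonneg

theorem isConnected_compl_zero (hn : 2 ≤ n) : IsConnected ({0}ᶜ : Set (E n)) := by
  refine isConnected_compl_singleton_of_one_lt_rank ?_ 0
  rw [← Module.finrank_eq_rank, finrank_euclideanSpace_fin]
  exact_mod_cast (by omega : 1 < n)

theorem IsSlopeOn.contDiffOn {m : ℝ} {w : ℝ → ℝ} (hw : IsSlopeOn m w (Ioi 0)) :
    ContDiffOn ℝ ∞ w (Ioi 0) := by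
  refine contDiffOn_infty.2 fun k => ?_
  induction k with
  | zero => exact contDiffOn_zero.2 hw.continuousOn
  | succ k ih =>
    push_cast
    refine (contDiffOn_succ_iff_deriv_of_isOpen isOpen_Ioi).2
      ⟨fun s hs => (hw s hs).2.differentiableAt.differentiableWithinAt, by simp, ?_⟩
    have hcoth : ContDiffOn ℝ k (fun s => Real.cosh s / Real.sinh s) (Ioi 0) :=
      Real.contDiff_cosh.contDiffOn.div Real.contDiff_sinh.contDiffOn fun s hs =>
        (Real.sinh_pos_iff.2 hs).ne'
    have h : ContDiffOn ℝ k (fun s => slopeField m s (w s)) (Ioi 0) :=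
      (contDiffOn_const.sub (ih.pow 2)).mul
        (contDiffOn_const.sub ((contDiffOn_const.mul hcoth).mul ih))
    exact h.congr fun s hs => (hw s hs).2.deriv

theorem IsProfile.contDiffOn {f w : ℝ → ℝ} (hf : IsProfile n f w) : ContDiffOn ℝ ∞ f (Ioi 0) := by
  refine (contDiffOn_infty_iff_deriv_of_isOpen isOpen_Ioi).2
    ⟨fun s hs => (hf.hasDerivAt s hs).differentiableAt.differentiableWithinAt, ?_⟩
  exact hf.isSlopeOn.contDiffOn.congr fun s hs => (hf.hasDerivAt s hs).deriv

/-- Profiles solve the translator equation away from the axis. -/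
theorem IsProfile.translatorAt {f w : ℝ → ℝ} (hf : IsProfile n f w) {y : E n} (hy : y ≠ 0) :
    SpacelikeAt (graphMap fun y => f (Real.arsinh ‖y‖)) y ∧
      TranslatorAt (graphMap fun y => f (Real.arsinh ‖y‖)) y := by
  have hs : 0 < Real.arsinh ‖y‖ := Real.arsinh_pos_iff.2 (norm_pos_iff.2 hy)
  have hfd : ∀ᶠ t in 𝓝 (Real.arsinh ‖y‖), HasDerivAt f (w t) t :=
    Filter.mem_of_superset (isOpen_Ioi.mem_nhds hs) hf.hasDerivAt
  have hslope := hf.isSlopeOn _ hs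
  exact ⟨(spacelikeAt_radial_iff hy hfd EventuallyEq.rfl).2 hslope.1,
    (translatorAt_radial_iff hy hfd hslope.2 hslope.1 EventuallyEq.rfl).2 rfl⟩

theorem IsProfile.isSpacelikeTranslator_Ioi {f w : ℝ → ℝ} (hf : IsProfile n f w) :
    IsSpacelikeTranslator ∞ (radialGraph n f (Ioi 0)) := by
  rw [radialGraph_Ioi_eq]
  refine isSpacelikeTranslator_graph (u := fun y => f (Real.arsinh ‖y‖)) (by simp)
    isOpen_compl_singleton ?_ fun y hy => hf.translatorAt hy
  have h1 : ContDiffOn ℝ ∞ (fun y : E n => Real.arsinh ‖y‖) {0}ᶜ := fun y hy =>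
    (Real.contDiff_arsinh.contDiffAt.comp y (contDiffAt_norm ℝ hy)).contDiffWithinAt
  exact hf.contDiffOn.comp h1 fun y hy => Real.arsinh_pos_iff.2 (norm_pos_iff.2 hy)

theorem IsProfile.hasDerivWithinAt_zero {f w : ℝ → ℝ} (hf : IsProfile n f w) {l : ℝ}
    (hl : Tendsto w (𝓝[>] 0) (𝓝 l)) : HasDerivWithinAt f l (Ici 0) 0 := by
  refine hasDerivWithinAt_Ici_of_tendsto_deriv (s := Ioi 0)
    (fun s hs => (hf.hasDerivAt s hs).differentiableAt.differentiableWithinAt)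
    ((hf.continuousOn 0 self_mem_Ici).mono Ioi_subset_Ici_self) self_mem_nhdsWithin ?_
  exact hl.congr' (eventually_mem_nhdsWithin.mono fun s hs => (hf.hasDerivAt s hs).deriv.symm)

/-- The deviation of a profile from its tangent cone on the axis. -/
theorem IsProfile.isLittleO_cone {f w : ℝ → ℝ} (hf : IsProfile n f w) {l : ℝ}
    (hl : Tendsto w (𝓝[>] 0) (𝓝 l)) :
    (fun y : E n => f (Real.arsinh ‖y‖) - f 0 - l * ‖y‖) =o[𝓝 0] fun y => y := by
  have h1 : HasDerivWithinAt f l (Ici 0) (Real.arsinh 0) := by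
    rw [Real.arsinh_zero]; exact hf.hasDerivWithinAt_zero hl
  have h2 : HasDerivWithinAt Real.arsinh 1 (Ici 0) 0 := by
    simpa using (Real.hasDerivAt_arsinh 0).hasDerivWithinAt (s := Ici 0)
  have h3 := h1.comp 0 h2 fun x hx => Real.arsinh_nonneg_iff.2 hx
  have h4 := (hasDerivWithinAt_iff_isLittleO.1 h3)
  have h5 : Tendsto (fun y : E n => ‖y‖) (𝓝 0) (𝓝[Ici 0] 0) :=
    tendsto_nhdsWithin_iff.2 ⟨by simpa using (continuous_norm (E := E n)).tendsto 0,
      .of_forall fun y => norm_nonneg y⟩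
  have h6 := h4.comp_tendsto h5
  refine (h6.congr_left fun y => ?_).trans_isBigO ?_
  · simp [mul_comm]
  · exact Asymptotics.IsBigO.of_bound 1 (.of_forall fun y => by simp)

/-- The coefficient P in du = P⟨y, ·⟩ takes the value 1/n at the axis, which is what the radial
equation demands at z = 0. The bounds 0 < w < tanh s / m keep P bounded, so
`contDiff_of_axis_equation` applies. -/
theorem IsProfile.bowl (hn : 2 ≤ n) {f w : ℝ → ℝ} (hf : IsProfile n f w)
    (hl : Tendsto w (𝓝[>] 0) (𝓝 0)) : IsSpacelikeTranslator ∞ (radialGraph n f (Ici 0)) := by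
  have hn0 : (n : ℝ) ≠ 0 := by positivity
  have hm : (1 : ℝ) ≤ (n : ℝ) - 1 := by
    have : (2 : ℝ) ≤ n := by exact_mod_cast hn
    linarith
  set P : E n → ℝ := fun y => if y = 0 then 1 / n else
    w (Real.arsinh ‖y‖) / (height y * ‖y‖) with hPdef
  have hPne : ∀ y : E n, y ≠ 0 → P =ᶠ[𝓝 y] fun y => w (Real.arsinh ‖y‖) / (height y * ‖y‖) :=
    fun y hy => Filter.mem_of_superset (isOpen_ne.mem_nhds hy) fun x hx => if_neg hx
  have hPb : ∀ y, |P y| ≤ 1 := by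
    intro y
    by_cases hy : y = 0
    · simp only [hPdef, hy, if_true]
      rw [abs_of_nonneg (by positivity), div_le_one (by positivity)]
      linarith
    · simp only [hPdef, hy, if_false]
      have hy0 : 0 < ‖y‖ := norm_pos_iff.2 hy
      have ha := height_pos y
      have ha1 : 1 ≤ height y ^ 2 := by rw [height_sq]; nlinarith [sq_nonneg ‖y‖]
      obtain ⟨h1, h2⟩ := hf.isSlopeOn.bounds_of_tendsto_zero (by linarith) hl
        (Real.arsinh_pos_iff.2 hy0)
      rw [abs_of_pos (by positivity), div_le_one (by positivity)]
      rw [Real.tanh_arsinh, ← height] at h2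
      refine h2.le.trans ?_
      rw [div_div, div_le_iff₀ (by positivity)]
      have e : height y * ‖y‖ * (height y * ((n : ℝ) - 1)) = ‖y‖ * (height y ^ 2 * ((n : ℝ) - 1)) := by
        ring
      rw [e]
      exact le_mul_of_one_le_right hy0.le (one_le_mul_of_one_le_of_one_le ha1 hm)
  have hP : ∀ y, y ≠ 0 → ∃ q, HasRadialDerivAt P q y ∧
      ‖y‖ ^ 2 * q + n * P y = 1 + ‖y‖ ^ 2 * axisTerm ((n : ℝ) - 1) (‖y‖ ^ 2) (P y) := by
    intro y hy
    have hy0 : 0 < ‖y‖ := norm_pos_iff.2 hy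
    have ha := height_pos y
    obtain ⟨-, hw⟩ := hf.isSlopeOn _ (Real.arsinh_pos_iff.2 hy0)
    have hq := hasRadialDerivAt_div_height hy hw
    refine ⟨_, hq.congr_of_eventuallyEq (hPne y hy), ?_⟩
    have h := (radialEquation_iff_axisTerm (by positivity)).1
      ((radialEquation_iff hy ((n : ℝ) - 1) (w (Real.arsinh ‖y‖)) _).2 rfl)
    rw [sub_add_cancel] at h
    rw [(hPne y hy).self_of_nhds]
    exact h
  obtain ⟨hPs, q, hq⟩ := contDiff_of_axis_equation hn hPb (if_pos rfl) hP
  set u : E n → ℝ := fun y => f (Real.arsinh ‖y‖)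
  have hu : ∀ y, HasRadialDerivAt u (P y) y := by
    intro y
    rcases eq_or_ne y 0 with rfl | hy
    -- With slope 0 the tangent cone is a horizontal plane, so u is differentiable at the origin
    -- with derivative 0.
    · have h := hf.isLittleO_cone hl (n := n)
      rw [HasRadialDerivAt, hasFDerivAt_iff_isLittleO_nhds_zero]
      simpa [u] using h
    · have h := hasRadialDerivAt_comp_arsinh hy
        (hf.hasDerivAt _ (Real.arsinh_pos_iff.2 (norm_pos_iff.2 hy)))
      have hPy : P y = w (Real.arsinh ‖y‖) / (height y * ‖y‖) := if_neg hy
      rwa [hPy]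
  have hus : ContDiff ℝ ∞ u := by
    refine contDiff_infty_iff_fderiv.2 ⟨fun y => HasFDerivAt.differentiableAt (hu y), ?_⟩
    rw [funext fun y => (hu y).fderiv]
    exact hPs.smul (innerSL ℝ).contDiff
  rw [radialGraph_Ici_eq]
  refine isSpacelikeTranslator_graph (u := u) (by simp) isOpen_univ hus.contDiffOn fun y _ => ?_
  rcases eq_or_ne y 0 with rfl | hy
  · have hD : 0 < 1 - (1 / height (0 : E n) ^ 2 + P 0 ^ 2) * ‖(0 : E n)‖ ^ 2 := by simp
    refine ⟨spacelikeAt_graphMap (hu 0) hD,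
      (translatorAt_graphMap_iff (.of_forall hu) (hq 0) hD).2 ?_⟩
    simp only [RadialEquation, hPdef, if_true, norm_zero]
    field_simp
    ring
  · exact hf.translatorAt hy

/-! ### The conic singularity -/

theorem tau_origin : tau (origin n) = 0 := by simp [tau, origin]

theorem origin_mem_hyp : origin n ∈ hyp n := by
  rw [mem_hyp_iff]; simp [origin, height]

theorem IsProfile.tendsto_cone {f w : ℝ → ℝ} (hf : IsProfile n f w) {l : ℝ}
    (hl : Tendsto w (𝓝[>] 0) (𝓝 l)) :
    Tendsto (fun p : L n => (f (tau p) - f (tau (origin n))) / tau p)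
      (𝓝[hyp n \ {origin n}] (origin n)) (𝓝 l) := by
  have h1 := (hasDerivWithinAt_iff_tendsto_slope.1 (hf.hasDerivWithinAt_zero hl))
  have h2 : Tendsto (tau (n := n)) (𝓝[hyp n \ {origin n}] (origin n)) (𝓝[Ici 0 \ {0}] 0) := by
    refine tendsto_nhdsWithin_iff.2 ⟨?_, ?_⟩
    · have hc : Continuous fun p : L n => Real.arsinh ‖p.1‖ :=
        Real.continuous_arsinh.comp (by fun_prop)
      have := hc.tendsto (origin n)
      simp only [origin, norm_zero, Real.arsinh_zero] at this
      refine (this.mono_left nhdsWithin_le_nhds).congr' ?_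
      filter_upwards [self_mem_nhdsWithin] with p hp
      exact (tau_eq hp.1).symm
    · filter_upwards [self_mem_nhdsWithin] with p hp
      rw [tau_eq hp.1]
      refine ⟨arsinh_norm_nonneg _, fun h0 => hp.2 ?_⟩
      have hp0 : p.1 = 0 := norm_eq_zero.1 (Real.arsinh_eq_zero_iff.1 h0)
      have := mem_hyp_iff.1 hp.1
      rw [hp0] at this
      refine Prod.ext hp0 (this.trans ?_)
      simp [height, origin]
  refine (h1.comp h2).congr fun p => ?_
  simp [slope_def_field, tau_origin]

/-- A graph with a conical point on the axis is not a `C¹` hypersurface. -/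
theorem not_isHypersurface_cone (hn : 1 ≤ n) {f w : ℝ → ℝ} (hf : IsProfile n f w) {l : ℝ}
    (hl : Tendsto w (𝓝[>] 0) (𝓝 l)) (hl0 : l ≠ 0) :
    ¬ IsHypersurface 1 {q : Ambient n | q.1 ∈ hyp n ∧ q.2 = f (tau q.1)} := by
  rintro ⟨-, hS⟩
  obtain ⟨U, X, hX, x₀, hx₀, hXx₀⟩ := hS (origin n, f 0) ⟨origin_mem_hyp, by rw [tau_origin]⟩
  have hUS : ∀ x ∈ U, (X x).1 ∈ hyp n ∧ (X x).2 = f (Real.arsinh ‖(X x).1.1‖) := by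
    intro x hx
    obtain ⟨V, -, hV⟩ := hX.image_eq
    obtain ⟨h1, h2⟩ := (hV.subset (mem_image_of_mem X hx)).1
    exact ⟨h1, by rw [h2, tau_eq h1]⟩
  set v : E n := basisVec ⟨0, hn⟩
  have hv : v ≠ 0 := by simp [v, basisVec]
  set D := fderiv ℝ X x₀ v
  have hγ : HasDerivAt (fun r : ℝ => X (x₀ + r • v)) D 0 := by
    have h1 : HasDerivAt (fun r : ℝ => x₀ + r • v) v 0 := by
      simpa using ((hasDerivAt_id (0 : ℝ)).smul_const v).const_add x₀
    have h2 : HasFDerivAt X (fderiv ℝ X x₀) ((fun r : ℝ => x₀ + r • v) 0) := by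
      simpa using ((hX.contDiffOn.contDiffAt (hX.isOpen.mem_nhds hx₀)).differentiableAt
        one_ne_zero).hasFDerivAt
    exact h2.comp_hasDerivAt (f := fun r : ℝ => x₀ + r • v) 0 h1
  have hU : ∀ᶠ r : ℝ in 𝓝 0, x₀ + r • v ∈ U := by
    have : Continuous fun r : ℝ => x₀ + r • v := by fun_prop
    refine this.continuousAt.eventually (hX.isOpen.mem_nhds ?_)
    simpa using hx₀
  set y : ℝ → E n := fun r => (X (x₀ + r • v)).1.1
  have hy : HasDerivAt y D.1.1 0 := hγ.fst.fst
  have ha : HasDerivAt (fun r : ℝ => (X (x₀ + r • v)).1.2) D.1.2 0 := hγ.fst.snd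
  have ht : HasDerivAt (fun r : ℝ => (X (x₀ + r • v)).2) D.2 0 := hγ.snd
  have hy0 : y 0 = 0 := by simp [y, hXx₀, origin]
  have hyO : y =O[𝓝 0] fun r : ℝ => r := by
    simpa [hy0] using hy.isBigO_sub
  have hyt : Tendsto y (𝓝 0) (𝓝 0) := by simpa [hy0] using hy.continuousAt.tendsto
  have hcone : (fun r => f (Real.arsinh ‖y r‖) - f 0 - l * ‖y r‖) =o[𝓝 0] fun r : ℝ => r :=
    ((hf.isLittleO_cone hl).comp_tendsto hyt).trans_isBigO hyO
  -- Up to o(r), ‖y‖ equals (t - f(0)) / l along the curve, so it is differentiable because t is.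
  -- Its minimum at 0 then forces velocity zero in every component, against the immersion.
  have hnorm : HasDerivAt (fun r => ‖y r‖) (D.2 / l) 0 := by
    have h1 : HasDerivAt (fun r => f (Real.arsinh ‖y r‖)) D.2 0 :=
      ht.congr_of_eventuallyEq (hU.mono fun r hr => ((hUS _ hr).2).symm)
    have h2 : HasDerivAt (fun r => f (Real.arsinh ‖y r‖) - f 0 - l * ‖y r‖) 0 0 := by
      rw [hasDerivAt_iff_isLittleO]
      simpa [hy0] using hcone
    have h3 := (h1.sub h2).div_const l
    rw [sub_zero] at h3
    have h4 := h3.sub_const (f 0 / l)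
    refine h4.congr_of_eventuallyEq (.of_forall fun r => ?_)
    simp only [Pi.sub_apply]
    field_simp
    ring
  have hmin : IsLocalMin (fun r => ‖y r‖) 0 :=
    .of_forall fun r => by simp [hy0]
  have hD2 : D.2 / l = 0 := hmin.hasDerivAt_eq_zero hnorm
  rw [hD2] at hnorm
  have hD11 : D.1.1 = 0 := by
    have h1 : HasDerivAt y 0 0 := by
      rw [hasDerivAt_iff_isLittleO] at hnorm ⊢
      simpa [hy0] using hnorm
    exact hy.unique h1
  have hD12 : D.1.2 = 0 := by
    rw [hD11] at hy
    have hr : HasFDerivAt height ((1 / height (y 0)) • innerSL ℝ (y 0)) (y 0) :=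
      hasRadialDerivAt_height (y 0)
    have h1 := hr.comp_hasDerivAt 0 hy
    rw [map_zero] at h1
    exact ha.unique (h1.congr_of_eventuallyEq (hU.mono fun r hr => mem_hyp_iff.1 (hUS _ hr).1))
  have hD : fderiv ℝ X x₀ v = fderiv ℝ X x₀ 0 := by
    rw [map_zero]
    exact Prod.ext (Prod.ext hD11 hD12) ((div_eq_zero_iff.1 hD2).resolve_right hl0)
  exact hv (hX.immersion x₀ hx₀ hD)

end HESU

theorem theorem4p1 (n : ℕ) (hn : 2 ≤ n) :
    -- every rotationally symmetric space-like translator is a piece of the graph of one `f ∘ τ`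
    (∀ S : Set (HESU.Ambient n), IsConnected S → HESU.IsRotationInvariant S →
      HESU.IsSpacelikeTranslator 2 S →
      ∃ (f w : ℝ → ℝ) (J : Set ℝ), HESU.IsProfile n f w ∧
        J.OrdConnected ∧ (∃ O : Set ℝ, IsOpen O ∧ J = O ∩ Ici 0) ∧
        S = HESU.radialGraph n f J ∧
        (0 ∈ J → Tendsto w (𝓝[>] 0) (𝓝 0)) ∧
        ∀ f' w' : ℝ → ℝ, HESU.IsProfile n f' w' → S ⊆ HESU.radialGraph n f' (Ici 0) →
          EqOn f' f (Ici 0) ∧ EqOn w' w (Ioi 0)) ∧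
    -- exactly one of the three types holds for every `f`
    (∀ f w : ℝ → ℝ, HESU.IsProfile n f w →
      ∃! l : ℝ, l ∈ ({0, 1, -1} : Set ℝ) ∧ Tendsto w (𝓝[>] 0) (𝓝 l)) ∧
    -- the bowl exists, is unique up to vertical translations, and is smooth on all of `ℍⁿ`
    (∃ f w : ℝ → ℝ, HESU.IsProfile n f w ∧ Tendsto w (𝓝[>] 0) (𝓝 0)) ∧
    (∀ f₁ w₁ f₂ w₂ : ℝ → ℝ, HESU.IsProfile n f₁ w₁ → Tendsto w₁ (𝓝[>] 0) (𝓝 0) →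
      HESU.IsProfile n f₂ w₂ → Tendsto w₂ (𝓝[>] 0) (𝓝 0) →
      EqOn w₁ w₂ (Ioi 0) ∧ ∃ c : ℝ, ∀ s, 0 ≤ s → f₂ s = f₁ s + c) ∧
    (∀ f w : ℝ → ℝ, HESU.IsProfile n f w → Tendsto w (𝓝[>] 0) (𝓝 0) →
      IsConnected (HESU.radialGraph n f (Ici 0)) ∧
      HESU.IsRotationInvariant (HESU.radialGraph n f (Ici 0)) ∧
      HESU.IsSpacelikeTranslator ∞ (HESU.radialGraph n f (Ici 0))) ∧
    -- the other two types exist, and are smooth except for a conic singularity on the axis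
    (∀ l ∈ ({1, -1} : Set ℝ),
      (∃ f w : ℝ → ℝ, HESU.IsProfile n f w ∧ Tendsto w (𝓝[>] 0) (𝓝 l)) ∧
      ∀ f w : ℝ → ℝ, HESU.IsProfile n f w → Tendsto w (𝓝[>] 0) (𝓝 l) →
        IsConnected (HESU.radialGraph n f (Ioi 0)) ∧
        HESU.IsRotationInvariant (HESU.radialGraph n f (Ioi 0)) ∧
        HESU.IsSpacelikeTranslator ∞ (HESU.radialGraph n f (Ioi 0)) ∧
        HESU.HasConicSingularity n (fun p => f (HESU.tau p)) l) := by
  have hm : (1 : ℝ) ≤ (n : ℝ) - 1 := by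
    have : (2 : ℝ) ≤ n := by exact_mod_cast hn
    linarith
  have hm0 : (0 : ℝ) < (n : ℝ) - 1 := by linarith
  refine ⟨fun S h1 h2 h3 => h3.classification hn h1 h2, ?_, ?_, ?_, ?_, ?_⟩
  · intro f w hf
    have key : ∃ l : ℝ, l ∈ ({0, 1, -1} : Set ℝ) ∧ Tendsto w (𝓝[>] 0) (𝓝 l) := by
      rcases hf.isSlopeOn.trichotomy hm0 with h | h | h
      · exact ⟨0, by simp, h⟩
      · exact ⟨1, by simp, h⟩
      · exact ⟨-1, by simp, h⟩
    obtain ⟨l, hl, hw⟩ := key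
    exact ⟨l, ⟨hl, hw⟩, fun l' hl' => tendsto_nhds_unique hl'.2 hw⟩
  · obtain ⟨w, hw, hl⟩ := HESU.exists_slope_tendsto_zero hm
    obtain ⟨f, -, hf⟩ := hw.exists_isProfile le_rfl 0
    exact ⟨f, w, hf, hl⟩
  · intro f₁ w₁ f₂ w₂ h₁ hl₁ h₂ hl₂
    have hw := h₁.isSlopeOn.eqOn_of_tendsto_zero hm0 h₂.isSlopeOn hl₁ hl₂
    exact ⟨hw, h₁.exists_add_const h₂ hw⟩
  · intro f w hf hl
    refine ⟨?_, HESU.isRotationInvariant_radialGraph f _, hf.bowl hn hl⟩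
    rw [HESU.radialGraph_Ici_eq]
    exact HESU.isConnected_graph isConnected_univ hf.continuous_comp_arsinh.continuousOn
  · intro l hl
    have hl0 : l ≠ 0 := by rcases hl with rfl | rfl <;> norm_num
    refine ⟨?_, fun f w hf hw => ⟨?_, HESU.isRotationInvariant_radialGraph f _,
      hf.isSpacelikeTranslator_Ioi, hf.tendsto_cone hw,
      HESU.not_isHypersurface_cone (by omega) hf hw hl0⟩⟩
    · have key : ∃ w, HESU.IsSlopeOn ((n : ℝ) - 1) w (Ioi 0) ∧ Tendsto w (𝓝[>] 0) (𝓝 l) := by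
        rcases hl with rfl | rfl
        · exact HESU.exists_slope_tendsto_one hm
        · exact HESU.exists_slope_tendsto_neg_one hm
      obtain ⟨w, hw, hlim⟩ := key
      obtain ⟨f, -, hf⟩ := hw.exists_isProfile le_rfl 0
      exact ⟨f, w, hf, hlim⟩
    · rw [HESU.radialGraph_Ioi_eq]
      exact HESU.isConnected_graph (HESU.isConnected_compl_zero hn)
        hf.continuous_comp_arsinh.continuousOn
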